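/- Let $d\ge 2$ and let $\mathscr F$ be a background field content, i.e. a 2-functor $\mathsf{Man}_d^{\mathrm{op}}\to\mathsf{Grpd}$ on $d$-manifolds and local diffeomorphisms (for example a stack). Let $\mathcal G=\mathsf{Sym}\,\mathsf{Cob}^{\mathscr F}_{d,d-1,d-2}$ be the symmetry groupoid. Its objects are quadruples $(M,f,\epsilon_1,\epsilon_2)$ of a closed $(d-2)$-manifold $M$, positive numbers $\epsilon_1,\epsilon_2$ for each connected component of $M$, and a field $f\in\mathscr F(M\times(-\epsilon_1,\epsilon_1)\times(-\epsilon_2,\epsilon_2))$ which is constant along $(-\epsilon_1,\epsilon_1)\times(-\epsilon_2,\epsilon_2)$ (it carries isomorphisms $t^*f|_{U_1}\to f|_{U_2}$, compatible with identities and composition, for all translations $t\colon U_2\to U_1$ between open subsets). Its morphisms are the limit 1-morphisms $(\phi,\Theta)$: a diffeomorphism $\phi\colon M_-\to M_+$ preserving the $\epsilon$'s and an isomorphism $\Theta\colon f_-\to\phi^*f_+$ which is constant (compatible with the translation isomorphisms). Let $\mathsf{2Vect}_{\mathbb C}$ be the bicategory of 2-vector spaces ($\mathbb C$-linear, additive,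 semisimple categories with finitely many simple objects and finite-dimensional morphism spaces), $\mathbb C$-linear functors and natural transformations. Let $\mathsf{Cob}$ be any bicategory with a 2-functor $\ell\colon\mathcal G\to\mathsf{Cob}$ ($\mathcal G$ having only trivial 2-morphisms); the case of interest is the geometric cobordism bicategory $\mathsf{Cob}^{\mathscr F}_{d,d-1,d-2}$ with the inclusion of the limit 1-morphisms. Let $\mathcal A\colon\mathsf{Cob}\to\mathsf{2Vect}_{\mathbb C}$ be a 2-functor which is invertible, i.e. there are a 2-functor $\mathcal A^{-1}$ and a natural 2-isomorphism (invertible up to invertible modifications) from the objectwise Deligne tensor product $\mathcal A\boxtimes\mathcal A^{-1}$ to the trivial theory $1$. Let $A\colon 1\Rightarrow\mathsf{tr}\,\mathcal A$ be a natural 2-transformation (with not necessarily invertible 2-morphisms $\mathcal A(g)\circ A_X\Rightarrow A_Y$ for $g\colon X\to Y$), where $\mathsf{tr}\,\mathcal A$ is the restriction of $\mathcal A$ to the sub-bicategory of $\mathsf{Cob}$ with all objects, all 1-morphisms and only invertible 2-morphisms. In particular this applies to every anomalous quantum field theory $A$ with invertible extended quantum field theory $\mathcal A$. A 2-cocycle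 of $\mathcal G$ is a family $\alpha_{g_2,g_1}\in\mathbb C^\times$, for composable $g_1,g_2$, with $\alpha_{g_3\circ g_2,g_1}\,\alpha_{g_3,g_2}=\alpha_{g_3,g_2\circ g_1}\,\alpha_{g_2,g_1}$, i.e. a 2-functor $\alpha\colon\mathcal G\to\mathsf B^2\mathbb C^\times\subset\mathsf{2Vect}_{\mathbb C}$. A projective representation of $\mathcal G$ twisted by $\alpha$ consists of finite-dimensional complex vector spaces $V_X$ and linear maps $\rho(g)\colon V_X\to V_Y$ for $g\colon X\to Y$ with $\rho(g_2)\circ\rho(g_1)=\alpha_{g_2,g_1}\,\rho(g_2\circ g_1)$ and $\rho(\mathrm{id}_X)=\alpha_{\mathrm{id}_X,\mathrm{id}_X}\,\mathrm{id}_{V_X}$; it gives a natural 2-transformation $1\Rightarrow\alpha$ with components $-\otimes V_X$ and 2-morphisms $\mathrm{id}\otimes\rho(g)$. Then: 1. There is a 2-cocycle $\alpha$ of $\mathcal G$ which, as a 2-functor $\mathcal G\to\mathsf{2Vect}_{\mathbb C}$, is naturally 2-isomorphic to the restriction $\mathcal A\circ\ell$ of $\mathcal A$ to $\mathcal G$.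 2. For every 2-cocycle $\alpha$ and every natural 2-isomorphism $e\colon\alpha\Rightarrow\mathcal A\circ\ell$, $A$ induces a projective representation $\rho$ of $\mathcal G$ twisted by $\alpha$: the restriction of $A$ to $\mathcal G$ is isomorphic, by an invertible modification, to the composite $1\overset{\rho}{\Rightarrow}\alpha\overset{e}{\Rightarrow}\mathcal A\circ\ell$. 3. The 2-cocycle is unique up to coboundary: if $\alpha$ and $\alpha'$ are both naturally 2-isomorphic to $\mathcal A\circ\ell$, then there are $\sigma_g\in\mathbb C^\times$ for all morphisms $g$ of $\mathcal G$ with $\sigma_{g_2\circ g_1}\,\alpha'_{g_2,g_1}=\alpha_{g_2,g_1}\,\sigma_{g_1}\,\sigma_{g_2}$ for all composable $g_1,g_2$. -/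

import Mathlib

open CategoryTheory CategoryTheory.Limits CategoryTheory.Bicategory
open scoped TensorProduct Pseudofunctor.StrongTrans Lax.LaxTrans

universe w v u w' v' u'

noncomputable section

namespace AnomalousQFT

/-! ### Background fields and the symmetry groupoid -/

section SymCob
open scoped Manifold ContDiff

/-- The model with corners of `(n+2)`-dimensional manifolds, with coordinates in `ℝⁿ × ℝ × ℝ`. -/
abbrev collarModel (n : ℕ) := (𝓡 n).prod (𝓘(ℝ, ℝ).prod 𝓘(ℝ, ℝ))

/-- A smooth manifold (Hausdorff, second countable, without boundary) of dimension `d = n + 2`.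
The objects of the category `Man n` of `d`-manifolds and local diffeomorphisms. -/
structure Man (n : ℕ) where
  carrier : Type
  [top : TopologicalSpace carrier]
  [charts : ChartedSpace (ModelProd (EuclideanSpace ℝ (Fin n)) (ModelProd ℝ ℝ)) carrier]
  [smooth : IsManifold (collarModel n) ∞ carrier]
  [hausdorff : T2Space carrier]
  [countable : SecondCountableTopology carrier]

attribute [instance] Man.top Man.charts Man.smooth Man.hausdorff Man.countable

/-- Morphisms in `Man n` are the smooth local diffeomorphisms. -/
@[ext]
structure Man.Hom {n : ℕ} (X Y : Man n) where
  toFun : X.carrier → Y.carrier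
  isLocalDiffeomorph : IsLocalDiffeomorph (collarModel n) (collarModel n) ∞ toFun

instance (n : ℕ) : Category (Man n) where
  Hom X Y := Man.Hom X Y
  id X := ⟨id, (Diffeomorph.refl (collarModel n) X.carrier ∞).isLocalDiffeomorph⟩
  comp f g := ⟨g.toFun ∘ f.toFun, fun x =>
    (f.isLocalDiffeomorph x).comp (hg := g.isLocalDiffeomorph (f.toFun x))⟩

@[ext]
theorem Man.hom_ext {n : ℕ} {X Y : Man n} {f g : X ⟶ Y} (h : ∀ x, f.toFun x = g.toFun x) : f = g :=
  Man.Hom.ext (funext h)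

/-- Background fields on `d`-dimensional manifolds: a 2-functor from `(Man n)ᵒᵖ` to groupoids.
(Stacks are the special case in which descent holds, which is not needed.) -/
structure BackgroundFields (n : ℕ) where
  toPseudofunctor : Pseudofunctor (LocallyDiscrete (Man n)ᵒᵖ) Cat.{v, u}
  isGroupoid (X : Man n) : IsGroupoid (toPseudofunctor.obj ⟨Opposite.op X⟩)

/-- An open subset as a manifold. -/
def Man.ofOpens {n : ℕ} {X : Man n} (U : TopologicalSpace.Opens X.carrier) : Man n where
  carrier := U
  charts := inferInstance
  smooth := inferInstance

theorem isLocalDiffeomorph_subtype_val {n : ℕ} {X : Man n} (U : TopologicalSpace.Opens X.carrier) :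
    IsLocalDiffeomorph (collarModel n) (collarModel n) ∞ (Subtype.val : U → X.carrier) := by
  intro x
  let e := (U.openPartialHomeomorphSubtypeCoe ⟨x⟩)
  have hs : e.source = Set.univ := rfl
  refine ⟨⟨e.toPartialEquiv, e.open_source, e.open_target, contMDiff_subtype_val.contMDiffOn, ?_⟩,
    Set.mem_univ _, fun _ _ => rfl⟩
  intro y hy
  have hy' : y ∈ U := by simpa [e] using hy
  refine ContMDiffAt.contMDiffWithinAt ?_
  refine (contMDiffAt_subtype_iff (x := (⟨y, hy'⟩ : U))).1 ?_
  have : (fun z : U => e.toPartialEquiv.symm z) = id := funext fun z => e.left_inv (Set.mem_univ z)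
  change ContMDiffAt _ _ _ (fun z : U => e.toPartialEquiv.symm z) _
  rw [this]
  exact contMDiffAt_id

/-- The inclusion of an open subset. -/
def Man.incl {n : ℕ} {X : Man n} (U : TopologicalSpace.Opens X.carrier) : Man.ofOpens U ⟶ X :=
  Man.Hom.mk Subtype.val (isLocalDiffeomorph_subtype_val U)

open scoped Pseudofunctor.CoGrothendieck

/-- The category of manifolds with background fields. A morphism `(X, f) ⟶ (Y, g)` is a local
diffeomorphism `t : X → Y` with a morphism `f ⟶ t^* g` in the groupoid of fields on `X`. -/
abbrev BackgroundFields.total {n : ℕ} (F : BackgroundFields.{v, u} n) :=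
  Pseudofunctor.CoGrothendieck F.toPseudofunctor

variable {n : ℕ} (F : BackgroundFields.{v, u} n)

/-- The restriction of a field to an open subset. -/
def restrictField {X : Man n} (f : F.toPseudofunctor.obj ⟨Opposite.op X⟩)
    (U : TopologicalSpace.Opens X.carrier) : F.total where
  base := Man.ofOpens U
  fiber := (F.toPseudofunctor.map (Man.incl U).op.toLoc).toFunctor.obj f

/-- The morphism `(U, f|_U) ⟶ (X, f)` covering the inclusion. -/
def restrictHom {X : Man n} (f : F.toPseudofunctor.obj ⟨Opposite.op X⟩)
    (U : TopologicalSpace.Opens X.carrier) : restrictField F f U ⟶ (⟨X, f⟩ : F.total) where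
  base := Man.incl U
  fiber := 𝟙 _

/-- A closed smooth manifold of dimension `n = d - 2`. -/
structure ClosedMan (n : ℕ) where
  carrier : Type
  [top : TopologicalSpace carrier]
  [charts : ChartedSpace (EuclideanSpace ℝ (Fin n)) carrier]
  [smooth : IsManifold (𝓡 n) ∞ carrier]
  [hausdorff : T2Space carrier]
  [compact : CompactSpace carrier]

attribute [instance] ClosedMan.top ClosedMan.charts ClosedMan.smooth ClosedMan.hausdorff
  ClosedMan.compact

instance (M : ClosedMan n) : SecondCountableTopology M.carrier :=
  ChartedSpace.secondCountable_of_sigmaCompact (EuclideanSpace ℝ (Fin n)) M.carrier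

/-- The manifold `M × ℝ × ℝ`. -/
@[simps]
def ClosedMan.prod (M : ClosedMan n) : Man n where
  carrier := M.carrier × ℝ × ℝ

open TopologicalSpace (Opens)

/-- A closed `n`-manifold `M` with widths `ε₁, ε₂`, one pair for each connected component. -/
structure Collar (n : ℕ) extends ClosedMan n where
  width₁ : ConnectedComponents carrier → ℝ
  width₂ : ConnectedComponents carrier → ℝ
  width₁_pos : ∀ c, 0 < width₁ c
  width₂_pos : ∀ c, 0 < width₂ c

/-- The open subset `M × (-ε₁, ε₁) × (-ε₂, ε₂)` of `M × ℝ × ℝ`. -/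
def Collar.region (C : Collar n) : Opens C.prod.carrier where
  carrier := {p | |p.2.1| < C.width₁ p.1 ∧ |p.2.2| < C.width₂ p.1}
  is_open' := by
    have : LocallyConnectedSpace C.carrier :=
      ChartedSpace.locallyConnectedSpace (EuclideanSpace ℝ (Fin n)) C.carrier
    have : DiscreteTopology (ConnectedComponents C.carrier) :=
      ConnectedComponents.discreteTopology_iff.2 fun x => isOpen_connectedComponent
    have h (w : ConnectedComponents C.carrier → ℝ) :
        Continuous fun p : C.carrier × ℝ × ℝ => w p.1 :=
      continuous_of_discreteTopology.comp (ConnectedComponents.continuous_coe.comp continuous_fst)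
    exact (isOpen_lt (continuous_abs.comp (continuous_fst.comp continuous_snd)) (h _)).inter
      (isOpen_lt (continuous_abs.comp (continuous_snd.comp continuous_snd)) (h _))

/-- The manifold `M × (-ε₁, ε₁) × (-ε₂, ε₂)`. -/
def Collar.man (C : Collar n) : Man n := Man.ofOpens C.region

/-- The coordinates in `M × ℝ × ℝ` of a point of `M × (-ε₁, ε₁) × (-ε₂, ε₂)`. -/
def Collar.coord (C : Collar n) (p : C.man.carrier) : C.carrier × ℝ × ℝ := p.1

theorem Collar.coord_injective (C : Collar n) : Function.Injective C.coord :=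
  Subtype.val_injective

/-- The map `t : U → V` between open subsets of the collar is the (bijective) translation by `v`. -/
def Collar.IsTranslation (C : Collar n) {U V : Opens C.man.carrier} (v : ℝ × ℝ)
    (t : Man.ofOpens U ⟶ Man.ofOpens V) : Prop :=
  Function.Bijective t.toFun ∧
    ∀ p : U, C.coord (t.toFun p).1 = ((C.coord p.1).1, (C.coord p.1).2 + v)

theorem Collar.isTranslation_id (C : Collar n) (U : Opens C.man.carrier) :
    C.IsTranslation 0 (𝟙 (Man.ofOpens U)) :=
  ⟨Function.bijective_id, fun p => by rw [add_zero]; rfl⟩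

theorem Collar.IsTranslation.comp {C : Collar n} {U V W : Opens C.man.carrier} {v w : ℝ × ℝ}
    {t : Man.ofOpens U ⟶ Man.ofOpens V} {s : Man.ofOpens V ⟶ Man.ofOpens W}
    (ht : C.IsTranslation v t) (hs : C.IsTranslation w s) : C.IsTranslation (v + w) (t ≫ s) :=
  ⟨hs.1.comp ht.1, fun p => by
    have h := hs.2 (t.toFun p)
    rw [ht.2] at h
    exact h.trans (by rw [add_assoc])⟩

theorem Collar.IsTranslation.eq {C : Collar n} {U V : Opens C.man.carrier} {v : ℝ × ℝ}
    {t s : Man.ofOpens U ⟶ Man.ofOpens V} (ht : C.IsTranslation v t) (hs : C.IsTranslation v s) :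
    t = s :=
  Man.hom_ext fun p => Subtype.ext (C.coord_injective ((ht.2 p).trans (hs.2 p).symm))

/-- An element of `F(M × (-ε₁, ε₁) × (-ε₂, ε₂))` which is constant along
`(-ε₁, ε₁) × (-ε₂, ε₂)`: it carries the structure of an invariant element under the groupoid of
all open subsets and all translations between them. The morphism `lift t`, which covers the
translation `t : U → V`, is the (inverse of the) structure isomorphism `t^* f|_V ⟶ f|_U`. -/
structure ConstField (C : Collar n) where
  field : F.toPseudofunctor.obj ⟨Opposite.op C.man⟩
  lift {U V : Opens C.man.carrier} (t : Man.ofOpens U ⟶ Man.ofOpens V)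
    (ht : ∃ v, C.IsTranslation v t) : restrictField F field U ⟶ restrictField F field V
  lift_base {U V : Opens C.man.carrier} (t : Man.ofOpens U ⟶ Man.ofOpens V)
    (ht : ∃ v, C.IsTranslation v t) : (lift t ht).base = t
  lift_id (U : Opens C.man.carrier) : lift (𝟙 (Man.ofOpens U)) ⟨0, C.isTranslation_id U⟩ = 𝟙 _
  lift_comp {U V W : Opens C.man.carrier} (t : Man.ofOpens U ⟶ Man.ofOpens V)
    (s : Man.ofOpens V ⟶ Man.ofOpens W) (ht : ∃ v, C.IsTranslation v t)
    (hs : ∃ w, C.IsTranslation w s) :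
    lift (t ≫ s) (ht.elim fun v hv => hs.elim fun w hw => ⟨v + w, hv.comp hw⟩) =
      lift t ht ≫ lift s hs

/-- The objects `(M, f, ε₁, ε₂)` of the geometric cobordism bicategory with background fields `F`,
which are also the objects of its symmetry groupoid. -/
structure SymCob where
  collar : Collar n
  constField : ConstField F collar

variable {F}

/-- The collar of an object with its background field, as an object of the total category. -/
def SymCob.total (X : SymCob F) : F.total := ⟨X.collar.man, X.constField.field⟩

/-- The restriction of the background field of an object to an open subset of its collar. -/
def SymCob.res (X : SymCob F) (U : Opens X.collar.man.carrier) : F.total :=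
  restrictField F X.constField.field U

/-- The morphism from the restricted background field covering the inclusion. -/
def SymCob.ι (X : SymCob F) (U : Opens X.collar.man.carrier) : X.res U ⟶ X.total :=
  restrictHom F X.constField.field U

/-- The lift of a translation given by the constant structure of the background field. -/
def SymCob.lift (X : SymCob F) {U V : Opens X.collar.man.carrier}
    (t : Man.ofOpens U ⟶ Man.ofOpens V) (ht : ∃ v, X.collar.IsTranslation v t) :
    X.res U ⟶ X.res V :=
  X.constField.lift t ht

/-- The underlying map of collars. -/
def SymCob.map {X Y : SymCob F} (f : X.total ⟶ Y.total) (p : X.collar.man.carrier) :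
    Y.collar.man.carrier :=
  f.base.toFun p

theorem SymCob.map_comp {X Y Z : SymCob F} (f : X.total ⟶ Y.total) (g : Y.total ⟶ Z.total)
    (p : X.collar.man.carrier) : SymCob.map (f ≫ g) p = SymCob.map g (SymCob.map f p) := rfl

theorem SymCob.continuous_map {X Y : SymCob F} (f : X.total ⟶ Y.total) :
    Continuous (SymCob.map f) :=
  f.base.isLocalDiffeomorph.contMDiff.continuous

theorem total_inv_apply {A B : F.total} (e : A ≅ B) (p : A.base.carrier) :
    e.inv.base.toFun (e.hom.base.toFun p) = p :=
  congrArg (fun f : A ⟶ A => f.base.toFun p) e.hom_inv_id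

theorem total_bijective {A B : F.total} (e : A ≅ B) : Function.Bijective e.hom.base.toFun :=
  Function.bijective_iff_has_inverse.2 ⟨e.inv.base.toFun, total_inv_apply e, total_inv_apply e.symm⟩

theorem SymCob.map_hom_inv {X Y : SymCob F} (Θ : X.total ≅ Y.total) (p : X.collar.man.carrier) :
    SymCob.map Θ.inv (SymCob.map Θ.hom p) = p := by
  rw [← SymCob.map_comp, Θ.hom_inv_id]
  rfl

theorem SymCob.map_inv_hom {X Y : SymCob F} (Θ : X.total ≅ Y.total) (q : Y.collar.man.carrier) :
    SymCob.map Θ.hom (SymCob.map Θ.inv q) = q := by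
  rw [← SymCob.map_comp, Θ.inv_hom_id]
  rfl

/-- `U` is the preimage of `V` under `f`. -/
def SymCob.Related {X Y : SymCob F} (f : X.total ⟶ Y.total) (U : Opens X.collar.man.carrier)
    (V : Opens Y.collar.man.carrier) : Prop :=
  ∀ p : X.collar.man.carrier, p ∈ U ↔ SymCob.map f p ∈ V

/-- An isomorphism `Θ` of background fields is constant: its restrictions `θ U V` to
corresponding open subsets (these restrictions are unique) commute with the structure
isomorphisms of corresponding translations. -/
def SymCob.IsConst {X Y : SymCob F} (Θ : X.total ≅ Y.total) : Prop :=
  ∃ θ : ∀ (U : Opens X.collar.man.carrier) (V : Opens Y.collar.man.carrier),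
      SymCob.Related Θ.hom U V → (X.res U ≅ Y.res V),
    (∀ U V h, (θ U V h).hom ≫ Y.ι V = X.ι U ≫ Θ.hom) ∧
    ∀ U U' V V' h h' v (t : Man.ofOpens U ⟶ Man.ofOpens U') (s : Man.ofOpens V ⟶ Man.ofOpens V')
      (ht : X.collar.IsTranslation v t) (hs : Y.collar.IsTranslation v s),
      (θ U V h).hom ≫ Y.lift s ⟨v, hs⟩ = X.lift t ⟨v, ht⟩ ≫ (θ U' V' h').hom

/-- Limit 1-morphisms: diffeomorphisms `φ` compatible with the widths, with a constant isomorphism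
`Θ : f ⟶ φ^* g` of background fields (that is, a constant isomorphism covering `φ × id`). -/
@[ext]
structure SymCob.Hom (X Y : SymCob F) where
  diffeo : Diffeomorph (𝓡 n) (𝓡 n) X.collar.carrier Y.collar.carrier ∞
  width₁_eq (x : X.collar.carrier) : Y.collar.width₁ (diffeo x) = X.collar.width₁ x
  width₂_eq (x : X.collar.carrier) : Y.collar.width₂ (diffeo x) = X.collar.width₂ x
  fieldIso : X.total ≅ Y.total
  map_eq (p : X.collar.man.carrier) : Y.collar.coord (SymCob.map fieldIso.hom p) =
    (diffeo (X.collar.coord p).1, (X.collar.coord p).2)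
  isConst : SymCob.IsConst fieldIso

theorem SymCob.isConst_refl (X : SymCob F) : SymCob.IsConst (Iso.refl X.total) := by
  have e {U V : Opens X.collar.man.carrier} (h : SymCob.Related (𝟙 X.total) U V) : U = V :=
    Opens.ext (Set.ext h)
  refine ⟨fun U V h => eqToIso (congrArg _ (e h)), fun U V h => ?_,
    fun U U' V V' h h' v t s ht hs => ?_⟩
  · obtain rfl := e h
    exact (Category.id_comp _).trans (Category.comp_id _).symm
  · obtain rfl := e h
    obtain rfl := e h'
    obtain rfl := ht.eq hs
    exact (Category.id_comp _).trans (Category.comp_id _).symm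

theorem SymCob.isConst_symm {X Y : SymCob F} {Θ : X.total ≅ Y.total} (h : SymCob.IsConst Θ) :
    SymCob.IsConst Θ.symm := by
  obtain ⟨θ, h₁, h₂⟩ := h
  have r {V U} (h : SymCob.Related Θ.symm.hom V U) : SymCob.Related Θ.hom U V := fun p => by
    rw [h, Iso.symm_hom, SymCob.map_hom_inv]
  refine ⟨fun V U h => (θ U V (r h)).symm, fun V U h => ?_,
    fun V V' U U' h h' v s t hs ht => ?_⟩
  · rw [Iso.symm_hom, Iso.inv_comp_eq, Iso.symm_hom, ← Category.assoc, h₁, Category.assoc,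
      Iso.hom_inv_id, Category.comp_id]
  · rw [Iso.symm_hom, Iso.inv_comp_eq, Iso.symm_hom, ← Category.assoc,
      h₂ U U' V V' _ (r h') v t s ht hs, Category.assoc, Iso.hom_inv_id, Category.comp_id]

theorem SymCob.isConst_trans {X Y Z : SymCob F} {Θ : X.total ≅ Y.total} {Ψ : Y.total ≅ Z.total}
    {φ : X.collar.carrier → Y.collar.carrier}
    (hΘ : ∀ p, Y.collar.coord (SymCob.map Θ.hom p) =
      (φ (X.collar.coord p).1, (X.collar.coord p).2))
    (h : SymCob.IsConst Θ) (h' : SymCob.IsConst Ψ) : SymCob.IsConst (Θ ≪≫ Ψ) := by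
  obtain ⟨θ, h₁, h₂⟩ := h
  obtain ⟨ψ, k₁, k₂⟩ := h'
  let pre (W : Opens Z.collar.man.carrier) : Opens Y.collar.man.carrier :=
    Opens.comap ⟨SymCob.map Ψ.hom, SymCob.continuous_map Ψ.hom⟩ W
  have r (W) : SymCob.Related Ψ.hom (pre W) W := fun _ => Iff.rfl
  have r' {U W} (h : SymCob.Related (Θ ≪≫ Ψ).hom U W) : SymCob.Related Θ.hom U (pre W) := h
  refine ⟨fun U W h => θ U (pre W) (r' h) ≪≫ ψ (pre W) W (r W), fun U W h => ?_,
    fun U U' W W' h h' v t s ht hs => ?_⟩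
  · rw [Iso.trans_hom, Category.assoc, k₁, ← Category.assoc, h₁, Category.assoc, Iso.trans_hom]
  · let m : Man.ofOpens (pre W) ⟶ Man.ofOpens (pre W') :=
      (θ U (pre W) (r' h)).inv.base ≫ t ≫ (θ U' (pre W') (r' h')).hom.base
    have hm : Y.collar.IsTranslation v m := by
      refine ⟨(total_bijective (θ U' (pre W') (r' h'))).comp
        (ht.1.comp (total_bijective (θ U (pre W) (r' h)).symm)), fun q => ?_⟩
      obtain ⟨p, rfl⟩ := (total_bijective (θ U (pre W) (r' h))).2 q
      have hp : m.toFun ((θ U (pre W) (r' h)).hom.base.toFun p) =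
          (θ U' (pre W') (r' h')).hom.base.toFun (t.toFun p) :=
        congrArg (fun p => (θ U' (pre W') (r' h')).hom.base.toFun (t.toFun p))
          (total_inv_apply (θ U (pre W) (r' h)) p)
      have e (U W) (h : SymCob.Related (Θ ≪≫ Ψ).hom U W) (p : U) :
          Y.collar.coord ((θ U (pre W) (r' h)).hom.base.toFun p).1 =
            (φ (X.collar.coord p.1).1, (X.collar.coord p.1).2) :=
        (congrArg (fun f : X.res U ⟶ Y.total => Y.collar.coord (f.base.toFun p))
          (h₁ U (pre W) (r' h))).trans (hΘ p.1)
      exact (congrArg (fun z => Y.collar.coord z.1) hp).trans ((e U' W' h' (t.toFun p)).trans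
        ((congrArg (fun z => (φ z.1, z.2)) (ht.2 p)).trans
          (congrArg (fun z => (z.1, z.2 + v)) (e U W h p)).symm))
    rw [Iso.trans_hom, Iso.trans_hom, Category.assoc, k₂ _ _ _ _ (r W) (r W') v m s hm hs,
      ← Category.assoc, h₂ _ _ _ _ (r' h) (r' h') v t m ht hm, Category.assoc]

/-- Limit 1-morphisms are composed as diffeomorphisms with an isomorphism of background fields. -/
instance : Category (SymCob F) where
  Hom X Y := SymCob.Hom X Y
  id X :=
    { diffeo := Diffeomorph.refl (𝓡 n) X.collar.carrier ∞
      width₁_eq := fun _ => rfl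
      width₂_eq := fun _ => rfl
      fieldIso := Iso.refl _
      map_eq := fun _ => rfl
      isConst := SymCob.isConst_refl X }
  comp f g :=
    { diffeo := f.diffeo.trans g.diffeo
      width₁_eq := fun x => (g.width₁_eq _).trans (f.width₁_eq x)
      width₂_eq := fun x => (g.width₂_eq _).trans (f.width₂_eq x)
      fieldIso := f.fieldIso ≪≫ g.fieldIso
      map_eq := fun p => by
        rw [Iso.trans_hom, SymCob.map_comp, g.map_eq, f.map_eq]
        rfl
      isConst := SymCob.isConst_trans f.map_eq f.isConst g.isConst }
  id_comp f := SymCob.Hom.ext (Diffeomorph.ext fun _ => rfl) (Iso.refl_trans _)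
  comp_id f := SymCob.Hom.ext (Diffeomorph.ext fun _ => rfl) (Iso.trans_refl _)
  assoc f g h := SymCob.Hom.ext (Diffeomorph.ext fun _ => rfl) (Iso.trans_assoc _ _ _)

/-- The symmetry groupoid of the geometric cobordism bicategory. -/
instance : Groupoid (SymCob F) where
  inv {X Y} f :=
    { diffeo := f.diffeo.symm
      width₁_eq := fun y => by rw [← f.width₁_eq, Diffeomorph.apply_symm_apply]
      width₂_eq := fun y => by rw [← f.width₂_eq, Diffeomorph.apply_symm_apply]
      fieldIso := f.fieldIso.symm
      map_eq := fun q => by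
        have h := f.map_eq (SymCob.map f.fieldIso.inv q)
        rw [SymCob.map_inv_hom] at h
        rw [h, Diffeomorph.symm_apply_apply]
        rfl
      isConst := SymCob.isConst_symm f.isConst }
  inv_comp f := SymCob.Hom.ext (Diffeomorph.ext f.diffeo.apply_symm_apply) f.fieldIso.symm_self_id
  comp_inv f := SymCob.Hom.ext (Diffeomorph.ext f.diffeo.symm_apply_apply) f.fieldIso.self_symm_id

end SymCob

/-! ### Two-vector spaces -/

/-- A (Kapranov-Voevodsky) 2-vector space: a `ℂ`-linear additive category which is semisimple with
finitely many simple objects `S i`, and with finite-dimensional morphism spaces. -/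
def IsKV (C : Type 1) [Category.{0} C] [Preadditive C] [Linear ℂ C] [HasFiniteBiproducts C] :
    Prop :=
  ∃ (n : ℕ) (S : Fin n → C),
    (∀ i j, FiniteDimensional ℂ (S i ⟶ S j)) ∧
    (∀ i j, Module.finrank ℂ (S i ⟶ S j) = if i = j then 1 else 0) ∧
    ∀ X : C, ∃ (m : ℕ) (f : Fin m → Fin n), Nonempty (X ≅ ⨁ fun k => S (f k))

/-- The objects of the 2-category of 2-vector spaces. -/
structure TwoVect where
  carrier : Type 1
  [cat : Category.{0} carrier]
  [preadditive : Preadditive carrier]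
  [linear : Linear ℂ carrier]
  [biproducts : HasFiniteBiproducts carrier]
  isKV : IsKV carrier

attribute [instance] TwoVect.cat TwoVect.preadditive TwoVect.linear TwoVect.biproducts

/-- `ℂ`-linear functors. -/
structure LinFun (V W : TwoVect) where
  functor : V.carrier ⥤ W.carrier
  [additive : functor.Additive]
  [linear : functor.Linear ℂ]

attribute [instance] LinFun.additive LinFun.linear

/-- Natural transformations. -/
@[ext]
structure LinFun.Hom {V W : TwoVect} (F G : LinFun V W) where
  nat : F.functor ⟶ G.functor

@[simps]
instance (V W : TwoVect) : Category (LinFun V W) where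
  Hom F G := LinFun.Hom F G
  id F := ⟨𝟙 F.functor⟩
  comp a b := ⟨a.nat ≫ b.nat⟩

@[ext]
theorem LinFun.hom_ext {V W : TwoVect} {F G : LinFun V W} {a b : F ⟶ G}
    (h : ∀ X, a.nat.app X = b.nat.app X) : a = b :=
  LinFun.Hom.ext (NatTrans.ext (funext h))

@[simps]
def LinFun.isoMk {V W : TwoVect} {F G : LinFun V W} (e : F.functor ≅ G.functor) : F ≅ G where
  hom := ⟨e.hom⟩
  inv := ⟨e.inv⟩

@[simps]
instance : CategoryStruct TwoVect where
  Hom V W := LinFun V W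
  id V := ⟨𝟭 V.carrier⟩
  comp F G := ⟨F.functor ⋙ G.functor⟩

theorem hom_eq {V W : TwoVect} {F G : LinFun V W} {a b : LinFun.Hom F G}
    (h : ∀ X, a.nat.app X = b.nat.app X) : a = b :=
  LinFun.Hom.ext (NatTrans.ext (funext h))

/-- The bicategory of 2-vector spaces, `ℂ`-linear functors and natural transformations. -/
instance : Bicategory TwoVect where
  homCategory V W := inferInstanceAs (Category (LinFun V W))
  whiskerLeft F _ _ a := ⟨Functor.whiskerLeft F.functor a.nat⟩
  whiskerRight a G := ⟨Functor.whiskerRight a.nat G.functor⟩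
  associator F G H := LinFun.isoMk (Functor.associator F.functor G.functor H.functor)
  leftUnitor F := LinFun.isoMk F.functor.leftUnitor
  rightUnitor F := LinFun.isoMk F.functor.rightUnitor
  whiskerLeft_id _ _ := rfl
  whiskerLeft_comp _ _ _ _ _ _ := rfl
  id_whiskerLeft a := hom_eq fun X =>
    (by simp : a.nat.app X = 𝟙 _ ≫ a.nat.app X ≫ 𝟙 _)
  comp_whiskerLeft F G _ _ a := hom_eq fun X =>
    (by simp : a.nat.app (G.functor.obj (F.functor.obj X)) = 𝟙 _ ≫ a.nat.app _ ≫ 𝟙 _)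
  id_whiskerRight F G := hom_eq fun X => G.functor.map_id _
  comp_whiskerRight _ _ G := hom_eq fun X => G.functor.map_comp _ _
  whiskerRight_id a := hom_eq fun X =>
    (by simp : a.nat.app X = 𝟙 _ ≫ a.nat.app X ≫ 𝟙 _)
  whiskerRight_comp a G H := hom_eq fun X =>
    (by simp : H.functor.map (G.functor.map (a.nat.app X)) =
      𝟙 _ ≫ H.functor.map (G.functor.map (a.nat.app X)) ≫ 𝟙 _)
  whisker_assoc F _ _ a H := hom_eq fun X =>
    (by simp : H.functor.map (a.nat.app (F.functor.obj X)) =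
      𝟙 _ ≫ H.functor.map (a.nat.app (F.functor.obj X)) ≫ 𝟙 _)
  whisker_exchange a b := hom_eq fun X => (b.nat.naturality (a.nat.app X)).symm
  pentagon F G H I := hom_eq fun X =>
    (by simp : I.functor.map (𝟙 (H.functor.obj (G.functor.obj (F.functor.obj X)))) ≫ 𝟙 _ ≫ 𝟙 _
      = 𝟙 _ ≫ 𝟙 _)
  triangle F G := hom_eq fun X =>
    (by simp : 𝟙 (G.functor.obj (F.functor.obj X)) ≫ 𝟙 _ = G.functor.map (𝟙 _))

theorem nonempty_iso_biproduct {C : Type 1} [Category.{0} C] [Preadditive C]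
    [HasFiniteBiproducts C] {J : Type} [Fintype J] {X : C} {Y : J → C} (ι : ∀ k, Y k ⟶ X) (π : ∀ k, X ⟶ Y k)
    (h₁ : ∀ k, ι k ≫ π k = 𝟙 _) (h₂ : ∀ k l, k ≠ l → ι k ≫ π l = 0)
    (h₃ : ∑ k, π k ≫ ι k = 𝟙 X) : Nonempty (X ≅ ⨁ Y) := by
  refine ⟨⟨biproduct.lift π, biproduct.desc ι, ?_, ?_⟩⟩
  · rw [biproduct.lift_desc, h₃]
  · ext k l
    by_cases h : k = l
    · subst h; simp [h₁]
    · simp [h₂ l k (Ne.symm h), biproduct.ι_π_ne _ (Ne.symm h)]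

instance : HasFiniteBiproducts (FGModuleCat.{0} ℂ) := HasFiniteBiproducts.of_hasFiniteProducts

theorem isKV_vect : IsKV (FGModuleCat.{0} ℂ) := by
  refine ⟨1, fun _ => FGModuleCat.of ℂ ℂ, fun _ _ => inferInstance, ?_, ?_⟩
  · intro i j
    rw [if_pos (Subsingleton.elim i j)]
    have e : (FGModuleCat.of ℂ ℂ ⟶ FGModuleCat.of ℂ ℂ) ≃ₗ[ℂ] (ℂ →ₗ[ℂ] ℂ) :=
      InducedCategory.homLinearEquiv ≪≫ₗ ModuleCat.homLinearEquiv
    rw [e.finrank_eq]; simp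
  · intro X
    let b := Module.finBasis ℂ X
    refine ⟨_, fun _ => 0, nonempty_iso_biproduct
      (fun k => FGModuleCat.ofHom (LinearMap.toSpanSingleton ℂ X (b k)))
      (fun k => FGModuleCat.ofHom (b.coord k)) ?_ ?_ ?_⟩
    · intro k
      ext
      change b.coord k ((1 : ℂ) • b k) = 1
      simp
    · intro k l h
      ext
      change b.coord l ((1 : ℂ) • b k) = 0
      simp [h]
    · let e : (X ⟶ X) ≃ₗ[ℂ] (X →ₗ[ℂ] X) := InducedCategory.homLinearEquiv ≪≫ₗ ModuleCat.homLinearEquiv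
      apply e.injective
      rw [map_sum]
      have h : ∑ k, LinearMap.toSpanSingleton ℂ X (b k) ∘ₗ b.coord k = LinearMap.id := by
        ext x
        simp [b.sum_repr]
      exact h

/-- The 2-vector space of finite-dimensional complex vector spaces. -/
def vect : TwoVect where
  carrier := FGModuleCat.{0} ℂ
  isKV := isKV_vect

/-- Formal tensor products of objects; `Hom (c ⊗ d) (c' ⊗ d') = Hom c c' ⊗ Hom d d'`. -/
structure Tens (C D : Type 1) where
  left : C
  right : D

section Tens
variable (C D : Type 1) [Category.{0} C] [Preadditive C] [Linear ℂ C]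
  [Category.{0} D] [Preadditive D] [Linear ℂ D]

instance : Category.{0} (Tens C D) where
  Hom X Y := (X.left ⟶ Y.left) ⊗[ℂ] (X.right ⟶ Y.right)
  id X := 𝟙 X.left ⊗ₜ 𝟙 X.right
  comp {X Y Z} f g := TensorProduct.map₂ (Linear.comp X.left Y.left Z.left)
    (Linear.comp X.right Y.right Z.right) f g
  id_comp {X Y} f := by
    induction f using TensorProduct.induction_on <;> simp_all
  comp_id f := by
    induction f using TensorProduct.induction_on <;> simp_all
  assoc f g h := by
    induction f using TensorProduct.induction_on with
    | zero => simp
    | add a b ha hb => simp only [map_add, LinearMap.add_apply, ha, hb]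
    | tmul a b =>
      induction g using TensorProduct.induction_on with
      | zero => simp
      | add a b ha hb => simp only [map_add, LinearMap.add_apply, ha, hb]
      | tmul c d =>
        induction h using TensorProduct.induction_on with
        | zero => simp
        | add a b ha hb => simp only [map_add, ha, hb]
        | tmul e f => simp

variable {C D}

/-- The pure tensor of two morphisms. -/
def Tens.tmul {X Y : Tens C D} (f : X.left ⟶ Y.left) (g : X.right ⟶ Y.right) : X ⟶ Y := f ⊗ₜ[ℂ] g

@[simp]
theorem Tens.tmul_comp {X Y Z : Tens C D} (f : X.left ⟶ Y.left) (g : X.right ⟶ Y.right)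
    (f' : Y.left ⟶ Z.left) (g' : Y.right ⟶ Z.right) :
    (Tens.tmul f g : X ⟶ Y) ≫ (Tens.tmul f' g' : Y ⟶ Z) = Tens.tmul (f ≫ f') (g ≫ g') :=
  rfl

@[simp]
theorem Tens.tmul_id (X : Tens C D) : (Tens.tmul (𝟙 X.left) (𝟙 X.right) : X ⟶ X) = 𝟙 X := rfl

instance : Preadditive (Tens C D) where
  homGroup X Y := inferInstanceAs (AddCommGroup ((X.left ⟶ Y.left) ⊗[ℂ] (X.right ⟶ Y.right)))
  add_comp X Y Z f f' g :=
    (TensorProduct.map₂ (Linear.comp X.left Y.left Z.left)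
      (Linear.comp X.right Y.right Z.right)).map_add₂ f f' g
  comp_add X Y Z f g g' :=
    (TensorProduct.map₂ (Linear.comp X.left Y.left Z.left)
      (Linear.comp X.right Y.right Z.right) f).map_add g g'

instance : Linear ℂ (Tens C D) where
  homModule X Y := inferInstanceAs (Module ℂ ((X.left ⟶ Y.left) ⊗[ℂ] (X.right ⟶ Y.right)))
  smul_comp X Y Z r f g :=
    (TensorProduct.map₂ (Linear.comp X.left Y.left Z.left)
      (Linear.comp X.right Y.right Z.right)).map_smul₂ r f g
  comp_smul X Y Z f r g :=
    (TensorProduct.map₂ (Linear.comp X.left Y.left Z.left)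
      (Linear.comp X.right Y.right Z.right) f).map_smul r g

end Tens

instance matLinear (C : Type 1) [Category.{0} C] [Preadditive C] [Linear ℂ C] :
    Linear ℂ (Mat_ C) where
  homModule M N := inferInstanceAs (Module ℂ (∀ i j, M.X i ⟶ N.X j))
  smul_comp X Y Z r f g := by
    ext i j
    change ∑ k, (r • f i k) ≫ g k j = r • ∑ k, f i k ≫ g k j
    simp [Finset.smul_sum]
  comp_smul X Y Z f r g := by
    ext i j
    change ∑ k, f i k ≫ (r • g k j) = r • ∑ k, f i k ≫ g k j
    simp [Finset.smul_sum]

section mapMat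
variable {C D E : Type 1} [Category.{0} C] [Preadditive C] [Category.{0} D] [Preadditive D]
  [Category.{0} E] [Preadditive E]

open Classical in
/-- The diagonal matrix with given diagonal entries. -/
def diag {ι : Type} [Fintype ι] {X Y : ι → C} (f : ∀ i, X i ⟶ Y i) :
    (Mat_.mk ι X : Mat_ C) ⟶ Mat_.mk ι Y :=
  fun i j => if h : i = j then f i ≫ eqToHom (congrArg Y h) else 0

theorem diag_id {ι : Type} [Fintype ι] (X : ι → C) :
    diag (fun i => 𝟙 (X i)) = 𝟙 (Mat_.mk ι X : Mat_ C) := by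
  ext i j
  by_cases h : i = j
  · subst h; simp [diag]
  · simp [diag, h]

theorem diag_comp {ι : Type} [Fintype ι] {X Y Z : ι → C} (f : ∀ i, X i ⟶ Y i)
    (g : ∀ i, Y i ⟶ Z i) : diag (fun i => f i ≫ g i) = diag f ≫ diag g := by
  ext i j
  rw [Mat_.comp_apply, Finset.sum_eq_single i]
  · by_cases h : i = j
    · subst h; simp [diag]
    · simp [diag, h]
  · intro k _ hk
    simp [diag, Ne.symm hk]
  · simp

theorem mapMat_diag (F : C ⥤ D) [F.Additive] {ι : Type} [Fintype ι] {X Y : ι → C}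
    (f : ∀ i, X i ⟶ Y i) : F.mapMat_.map (diag f) = diag (fun i => F.map (f i)) := by
  refine funext fun (i : ι) => funext fun (j : ι) => ?_
  change F.map (diag f i j) = diag (fun i => F.map (f i)) i j
  by_cases h : i = j
  · subst h; simp [diag]
  · simp [diag, h]

theorem comp_diag {M : Mat_ C} {ι : Type} [Fintype ι] {X Y : ι → C} (f : M ⟶ ⟨ι, X⟩)
    (g : ∀ i, X i ⟶ Y i) (i : M.ι) (j : ι) : (f ≫ diag g) i j = f i j ≫ g j := by
  rw [Mat_.comp_apply, Finset.sum_eq_single j]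
  · simp [diag]
  · intro k _ hk
    simp [diag, hk]
  · simp

theorem diag_comp_apply {M : Mat_ C} {ι : Type} [Fintype ι] {X Y : ι → C} (g : ∀ i, X i ⟶ Y i)
    (f : (⟨ι, Y⟩ : Mat_ C) ⟶ M) (i : ι) (j : M.ι) : (diag g ≫ f) i j = g i ≫ f i j := by
  rw [Mat_.comp_apply, Finset.sum_eq_single i]
  · simp [diag]
  · intro k _ hk
    simp [diag, Ne.symm hk]
  · simp

/-- Entrywise extension of a natural transformation to matrices. -/
def mapMatNat {F G : C ⥤ D} [F.Additive] [G.Additive] (a : F ⟶ G) : F.mapMat_ ⟶ G.mapMat_ where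
  app M := diag (fun i => a.app (M.X i))
  naturality M N f := by
    refine funext fun i => funext fun j => ?_
    refine (comp_diag (F.mapMat_.map f) (fun i => a.app (N.X i)) i j).trans
      (Eq.trans ?_ (diag_comp_apply (fun i => a.app (M.X i)) (G.mapMat_.map f) i j).symm)
    exact a.naturality (f i j)

end mapMat

section TensFunctor
variable {C D C' D' : Type 1} [Category.{0} C] [Preadditive C] [Linear ℂ C]
  [Category.{0} D] [Preadditive D] [Linear ℂ D] [Category.{0} C'] [Preadditive C'] [Linear ℂ C']
  [Category.{0} D'] [Preadditive D'] [Linear ℂ D']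

theorem tens_map_comp (F : C ⥤ C') [F.Additive] [F.Linear ℂ] (G : D ⥤ D') [G.Additive]
    [G.Linear ℂ] {X Y Z : Tens C D} (f : (X.left ⟶ Y.left) ⊗[ℂ] (X.right ⟶ Y.right))
    (g : (Y.left ⟶ Z.left) ⊗[ℂ] (Y.right ⟶ Z.right)) :
    TensorProduct.map (F.mapLinearMap ℂ) (G.mapLinearMap ℂ)
      (TensorProduct.map₂ (Linear.comp X.left Y.left Z.left)
        (Linear.comp X.right Y.right Z.right) f g) =
    TensorProduct.map₂ (Linear.comp (F.obj X.left) (F.obj Y.left) (F.obj Z.left))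
      (Linear.comp (G.obj X.right) (G.obj Y.right) (G.obj Z.right))
      (TensorProduct.map (F.mapLinearMap ℂ) (G.mapLinearMap ℂ) f)
      (TensorProduct.map (F.mapLinearMap ℂ) (G.mapLinearMap ℂ) g) := by
  induction f using TensorProduct.induction_on with
  | zero => simp
  | add a b ha hb => simp only [map_add, LinearMap.add_apply, ha, hb]
  | tmul a b =>
    induction g using TensorProduct.induction_on with
    | zero => simp
    | add a b ha hb => simp only [map_add, ha, hb]
    | tmul c d => simp

/-- The functor `F ⊗ G` on tensor products of morphism spaces. -/
def tensFunctor (F : C ⥤ C') [F.Additive] [F.Linear ℂ] (G : D ⥤ D') [G.Additive] [G.Linear ℂ] :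
    Tens C D ⥤ Tens C' D' where
  obj X := ⟨F.obj X.left, G.obj X.right⟩
  map {X Y} f := TensorProduct.map (F.mapLinearMap ℂ) (G.mapLinearMap ℂ)
    (f : (X.left ⟶ Y.left) ⊗[ℂ] (X.right ⟶ Y.right))
  map_id X := by
    change F.map (𝟙 X.left) ⊗ₜ[ℂ] G.map (𝟙 X.right) = 𝟙 _ ⊗ₜ[ℂ] 𝟙 _
    rw [F.map_id, G.map_id]
  map_comp f g := tens_map_comp F G f g

instance (F : C ⥤ C') [F.Additive] [F.Linear ℂ] (G : D ⥤ D') [G.Additive] [G.Linear ℂ] :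
    (tensFunctor F G).Additive where
  map_add := (TensorProduct.map (F.mapLinearMap ℂ) (G.mapLinearMap ℂ)).map_add _ _

instance (F : C ⥤ C') [F.Additive] [F.Linear ℂ] (G : D ⥤ D') [G.Additive] [G.Linear ℂ] :
    (tensFunctor F G).Linear ℂ where
  map_smul f r := (TensorProduct.map (F.mapLinearMap ℂ) (G.mapLinearMap ℂ)).map_smul r f

theorem tens_naturality {F F' : C ⥤ C'} [F.Additive] [F.Linear ℂ] [F'.Additive] [F'.Linear ℂ]
    {G G' : D ⥤ D'} [G.Additive] [G.Linear ℂ] [G'.Additive] [G'.Linear ℂ] (a : F ⟶ F') (b : G ⟶ G')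
    {X Y : Tens C D} (f : (X.left ⟶ Y.left) ⊗[ℂ] (X.right ⟶ Y.right)) :
    TensorProduct.map₂ (Linear.comp (F.obj X.left) (F.obj Y.left) (F'.obj Y.left))
      (Linear.comp (G.obj X.right) (G.obj Y.right) (G'.obj Y.right))
      (TensorProduct.map (F.mapLinearMap ℂ) (G.mapLinearMap ℂ) f)
      (a.app Y.left ⊗ₜ b.app Y.right) =
    TensorProduct.map₂ (Linear.comp (F.obj X.left) (F'.obj X.left) (F'.obj Y.left))
      (Linear.comp (G.obj X.right) (G'.obj X.right) (G'.obj Y.right))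
      (a.app X.left ⊗ₜ b.app X.right)
      (TensorProduct.map (F'.mapLinearMap ℂ) (G'.mapLinearMap ℂ) f) := by
  induction f using TensorProduct.induction_on with
  | zero => simp
  | add a b ha hb => simp only [map_add, LinearMap.add_apply, ha, hb]
  | tmul a b => simp

/-- The natural transformation `a ⊗ b`. -/
def tensNat {F F' : C ⥤ C'} [F.Additive] [F.Linear ℂ] [F'.Additive] [F'.Linear ℂ]
    {G G' : D ⥤ D'} [G.Additive] [G.Linear ℂ] [G'.Additive] [G'.Linear ℂ] (a : F ⟶ F') (b : G ⟶ G') :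
    tensFunctor F G ⟶ tensFunctor F' G' where
  app X := Tens.tmul (X := ⟨F.obj X.left, G.obj X.right⟩) (Y := ⟨F'.obj X.left, G'.obj X.right⟩)
    (a.app X.left) (b.app X.right)
  naturality _ _ f := tens_naturality a b f

end TensFunctor

theorem tens_decomp {C D : Type 1} [Category.{0} C] [Preadditive C] [Linear ℂ C]
    [HasFiniteBiproducts C] [Category.{0} D] [Preadditive D] [Linear ℂ D] [HasFiniteBiproducts D]
    {J K : Type} [Fintype J] [Fintype K] {S : J → C} {T : K → D} (X : Tens C D)
    (e : X.left ≅ ⨁ S) (e' : X.right ≅ ⨁ T) :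
    Nonempty ((Mat_.embedding (Tens C D)).obj X ≅
      ⨁ fun p : J × K => (Mat_.embedding (Tens C D)).obj ⟨S p.1, T p.2⟩) := by
  classical
  let F := Mat_.embedding (Tens C D)
  let ι (p : J × K) : (⟨S p.1, T p.2⟩ : Tens C D) ⟶ X :=
    Tens.tmul (biproduct.ι S p.1 ≫ e.inv) (biproduct.ι T p.2 ≫ e'.inv)
  let π (p : J × K) : X ⟶ (⟨S p.1, T p.2⟩ : Tens C D) :=
    Tens.tmul (e.hom ≫ biproduct.π S p.1) (e'.hom ≫ biproduct.π T p.2)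
  refine nonempty_iso_biproduct (fun p => F.map (ι p)) (fun p => F.map (π p)) ?_ ?_ ?_
  · intro p
    rw [← F.map_comp, ← F.map_id]
    congr 1
    simp [ι, π]
    rfl
  · rintro ⟨j, k⟩ ⟨j', k'⟩ h
    rw [← F.map_comp]
    have : ι (j, k) ≫ π (j', k') = 0 := by
      simp only [ι, π, Tens.tmul_comp, Category.assoc, Iso.inv_hom_id_assoc]
      by_cases hj : j = j'
      · have hk : k ≠ k' := fun hk => h (by rw [hj, hk])
        rw [biproduct.ι_π_ne T hk]
        exact TensorProduct.tmul_zero _ _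
      · rw [biproduct.ι_π_ne S hj]
        exact TensorProduct.zero_tmul _ _
    rw [this]
    rfl
  · have : ∑ p, π p ≫ ι p = 𝟙 X := by
      have hl : 𝟙 X.left = ∑ j, (e.hom ≫ biproduct.π S j) ≫ biproduct.ι S j ≫ e.inv := by
        simp only [Category.assoc, ← Preadditive.comp_sum]
        simp only [← Category.assoc, ← Preadditive.sum_comp]
        simp [biproduct.total]
      have hr : 𝟙 X.right = ∑ j, (e'.hom ≫ biproduct.π T j) ≫ biproduct.ι T j ≫ e'.inv := by
        simp only [Category.assoc, ← Preadditive.comp_sum]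
        simp only [← Category.assoc, ← Preadditive.sum_comp]
        simp [biproduct.total]
      rw [← Tens.tmul_id, hl, hr]
      unfold Tens.tmul
      erw [TensorProduct.sum_tmul]
      rw [Fintype.sum_prod_type]
      refine Finset.sum_congr rfl fun j _ => ?_
      erw [TensorProduct.tmul_sum]
      rfl
    change ∑ p, F.map (π p) ≫ F.map (ι p) = 𝟙 (F.obj X)
    rw [← F.map_id, ← this, F.map_sum]
    simp only [F.map_comp]

theorem isKV_deligne (V W : TwoVect) : IsKV (Mat_ (Tens V.carrier W.carrier)) := by
  obtain ⟨n, S, hS, hS', hSd⟩ := V.isKV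
  obtain ⟨m, T, hT, hT', hTd⟩ := W.isKV
  let c : Fin n × Fin m ≃ Fin (n * m) := finProdFinEquiv
  let F := Mat_.embedding (Tens V.carrier W.carrier)
  let R (p : Fin n × Fin m) : Mat_ (Tens V.carrier W.carrier) := F.obj ⟨S p.1, T p.2⟩
  have hom (p q : Fin n × Fin m) :
      (R p ⟶ R q) ≃ₗ[ℂ] (S p.1 ⟶ S q.1) ⊗[ℂ] (T p.2 ⟶ T q.2) :=
    (LinearEquiv.funUnique PUnit ℂ (PUnit → (S p.1 ⟶ S q.1) ⊗[ℂ] (T p.2 ⟶ T q.2))) ≪≫ₗ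
      LinearEquiv.funUnique PUnit ℂ _
  refine ⟨n * m, fun k => R (c.symm k), fun i j => ?_, fun i j => ?_, fun M => ?_⟩
  · exact Module.Finite.equiv (hom (c.symm i) (c.symm j)).symm
  · rw [(hom (c.symm i) (c.symm j)).finrank_eq, Module.finrank_tensorProduct, hS', hT']
    by_cases h : i = j
    · simp [h]
    · have h' : ¬ ((c.symm i).1 = (c.symm j).1 ∧ (c.symm i).2 = (c.symm j).2) := fun h' =>
        h (c.symm.injective (Prod.ext h'.1 h'.2))
      rw [if_neg h]
      by_cases h1 : (c.symm i).1 = (c.symm j).1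
      · rw [if_neg fun h2 => h' ⟨h1, h2⟩, mul_zero]
      · rw [if_neg h1, zero_mul]
  · choose a f ha using hSd
    choose b g hb using hTd
    have e₁ (i : M.ι) := (tens_decomp (M.X i) (ha (M.X i).left).some (hb (M.X i).right).some).some
    let J (i : M.ι) := Fin (a (M.X i).left) × Fin (b (M.X i).right)
    let r (i : M.ι) (p : J i) : Fin n × Fin m := (f (M.X i).left p.1, g (M.X i).right p.2)
    have e₂ : M ≅ ⨁ fun p : Σ i, J i => R (r p.1 p.2) :=
      Mat_.isoBiproductEmbedding M ≪≫ biproduct.mapIso e₁ ≪≫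
        biproductBiproductIso J fun i p => R (r i p)
    let k := Fintype.equivFin (Σ i, J i)
    exact ⟨_, fun l => c (r (k.symm l).1 (k.symm l).2), ⟨e₂ ≪≫ biproduct.whiskerEquiv k
      (fun p => eqToIso ((congrArg R (c.symm_apply_apply _)).trans
        (congrArg (fun p : Σ i, J i => R (r p.1 p.2)) (k.symm_apply_apply p))))⟩⟩

/-- The Deligne tensor product `V ⊠ W`: its objects are the finite formal direct sums of formal
tensor products `c ⊗ d`, and its morphisms are matrices of elements of `Hom c c' ⊗ Hom d d'`. -/
def deligne (V W : TwoVect) : TwoVect where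
  carrier := Mat_ (Tens V.carrier W.carrier)
  isKV := isKV_deligne V W

instance mapMatAdditive {C D : Type 1} [Category.{0} C] [Preadditive C]
    [Category.{0} D] [Preadditive D] (F : C ⥤ D) [F.Additive] :
    F.mapMat_.Additive where
  map_add := funext fun _ => funext fun _ => F.map_add

instance mapMatLinear {C D : Type 1} [Category.{0} C] [Preadditive C] [Linear ℂ C]
    [Category.{0} D] [Preadditive D] [Linear ℂ D] (F : C ⥤ D) [F.Additive] [F.Linear ℂ] :
    F.mapMat_.Linear ℂ where
  map_smul f r := funext fun i => funext fun j => F.map_smul r (f i j)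

/-- The functor `F ⊠ G`. -/
def deligneMap {V V' W W' : TwoVect} (F : V ⟶ V') (G : W ⟶ W') : deligne V W ⟶ deligne V' W' :=
  LinFun.mk (V := deligne V W) (W := deligne V' W') (tensFunctor F.functor G.functor).mapMat_
    (additive := mapMatAdditive _) (linear := mapMatLinear _)

/-- The natural transformation `a ⊠ b`. -/
def deligneMap₂ {V V' W W' : TwoVect} {F F' : V ⟶ V'} {G G' : W ⟶ W'} (a : F ⟶ F') (b : G ⟶ G') :
    deligneMap F G ⟶ deligneMap F' G' :=
  LinFun.Hom.mk (F := deligneMap F G) (G := deligneMap F' G') (mapMatNat (tensNat a.nat b.nat))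

theorem deligneMap₂_id {V V' W W' : TwoVect} (F : V ⟶ V') (G : W ⟶ W') :
    deligneMap₂ (𝟙 F) (𝟙 G) = 𝟙 (deligneMap F G) :=
  hom_eq fun (M : Mat_ (Tens V.carrier W.carrier)) =>
    diag_id (fun i : M.ι => (tensFunctor F.functor G.functor).obj (M.X i))

theorem deligneMap₂_comp {V V' W W' : TwoVect} {F F' F'' : V ⟶ V'} {G G' G'' : W ⟶ W'}
    (a : F ⟶ F') (a' : F' ⟶ F'') (b : G ⟶ G') (b' : G' ⟶ G'') :
    deligneMap₂ (a ≫ a') (b ≫ b') = deligneMap₂ a b ≫ deligneMap₂ a' b' :=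
  hom_eq fun (M : Mat_ (Tens V.carrier W.carrier)) =>
    diag_comp (fun i : M.ι => (tensNat a.nat b.nat).app (M.X i))
      (fun i : M.ι => (tensNat a'.nat b'.nat).app (M.X i))

/-- The isomorphism `a ⊠ b`. -/
@[simps]
def deligneMap₂Iso {V V' W W' : TwoVect} {F F' : V ⟶ V'} {G G' : W ⟶ W'} (a : F ≅ F')
    (b : G ≅ G') : deligneMap F G ≅ deligneMap F' G' where
  hom := deligneMap₂ a.hom b.hom
  inv := deligneMap₂ a.inv b.inv
  hom_inv_id := by rw [← deligneMap₂_comp, a.hom_inv_id, b.hom_inv_id, deligneMap₂_id]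
  inv_hom_id := by rw [← deligneMap₂_comp, a.inv_hom_id, b.inv_hom_id, deligneMap₂_id]

theorem tens_id_map {C D : Type 1} [Category.{0} C] [Preadditive C] [Linear ℂ C]
    [Category.{0} D] [Preadditive D] [Linear ℂ D] {M N : Mat_ (Tens C D)} (f : M ⟶ N) :
    (tensFunctor (𝟭 C) (𝟭 D)).mapMat_.map f = f := by
  refine funext fun i => funext fun j => ?_
  exact LinearMap.congr_fun TensorProduct.map_id _

/-- `𝟙 ⊠ 𝟙 ≅ 𝟙`. -/
def deligneId (V W : TwoVect) : deligneMap (𝟙 V) (𝟙 W) ≅ 𝟙 (deligne V W) :=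
  LinFun.isoMk (F := deligneMap (𝟙 V) (𝟙 W)) (G := 𝟙 (deligne V W))
    (NatIso.ofComponents (fun M => Iso.refl (C := Mat_ (Tens V.carrier W.carrier)) M) (fun f =>
      (Category.comp_id (obj := Mat_ (Tens V.carrier W.carrier)) _).trans ((tens_id_map f).trans
        (Category.id_comp (obj := Mat_ (Tens V.carrier W.carrier)) f).symm)))

/-- `(F ≫ F') ⊠ (G ≫ G') ≅ (F ⊠ G) ≫ (F' ⊠ G')`. -/
def deligneComp {V₁ V₂ V₃ W₁ W₂ W₃ : TwoVect} (F : V₁ ⟶ V₂) (F' : V₂ ⟶ V₃) (G : W₁ ⟶ W₂)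
    (G' : W₂ ⟶ W₃) : deligneMap (F ≫ F') (G ≫ G') ≅ deligneMap F G ≫ deligneMap F' G' :=
  LinFun.isoMk (F := deligneMap (F ≫ F') (G ≫ G')) (G := deligneMap F G ≫ deligneMap F' G')
    (NatIso.ofComponents (fun M => Iso.refl (C := Mat_ (Tens V₃.carrier W₃.carrier))
      (((tensFunctor F'.functor G'.functor).mapMat_).obj
        ((tensFunctor F.functor G.functor).mapMat_.obj M))) (fun f =>
      (Category.comp_id (obj := Mat_ (Tens V₃.carrier W₃.carrier)) _).trans (Eq.trans
        (funext fun i => funext fun j => LinearMap.congr_fun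
          (TensorProduct.map_comp (F'.functor.mapLinearMap ℂ) (G'.functor.mapLinearMap ℂ)
            (F.functor.mapLinearMap ℂ) (G.functor.mapLinearMap ℂ)) (f i j))
        (Category.id_comp (obj := Mat_ (Tens V₃.carrier W₃.carrier)) _).symm)))

section Coherence
variable {V₁ V₂ V₃ V₄ W₁ W₂ W₃ W₄ : TwoVect}

theorem deligneMap₂_eq_id {V V' W W' : TwoVect} {F : V ⟶ V'} {G : W ⟶ W'}
    (M : Mat_ (Tens V.carrier W.carrier)) :
    diag (fun i : M.ι => Tens.tmul (𝟙 (F.functor.obj (M.X i).left))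
      (𝟙 (G.functor.obj (M.X i).right))) =
      𝟙 ((tensFunctor F.functor G.functor).mapMat_.obj M) :=
  diag_id (fun i : M.ι => (tensFunctor F.functor G.functor).obj (M.X i))

theorem deligneComp_whiskerLeft (F : V₁ ⟶ V₂) (G : W₁ ⟶ W₂) {F' F'' : V₂ ⟶ V₃} {G' G'' : W₂ ⟶ W₃}
    (a : F' ⟶ F'') (b : G' ⟶ G'') :
    deligneMap₂ (F ◁ a) (G ◁ b) =
      (deligneComp F F' G G').hom ≫ deligneMap F G ◁ deligneMap₂ a b ≫
        (deligneComp F F'' G G'').inv :=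
  hom_eq fun (M : Mat_ (Tens V₁.carrier W₁.carrier)) => by
    let x := (deligneMap₂ a b).nat.app ((deligneMap F G).functor.obj M)
    change x = 𝟙 _ ≫ x ≫ 𝟙 _
    simp

theorem deligneComp_whiskerRight {F F' : V₁ ⟶ V₂} {G G' : W₁ ⟶ W₂} (a : F ⟶ F') (b : G ⟶ G')
    (F'' : V₂ ⟶ V₃) (G'' : W₂ ⟶ W₃) :
    deligneMap₂ (a ▷ F'') (b ▷ G'') =
      (deligneComp F F'' G G'').hom ≫ deligneMap₂ a b ▷ deligneMap F'' G'' ≫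
        (deligneComp F' F'' G' G'').inv :=
  hom_eq fun (M : Mat_ (Tens V₁.carrier W₁.carrier)) => by
    let x := (tensFunctor F''.functor G''.functor).mapMat_.map
      (diag fun i : M.ι => (tensNat a.nat b.nat).app (M.X i))
    change diag (fun i : M.ι => (tensFunctor F''.functor G''.functor).map
      ((tensNat a.nat b.nat).app (M.X i))) = 𝟙 _ ≫ x ≫ 𝟙 _
    rw [Category.id_comp, Category.comp_id]
    exact (mapMat_diag _ _).symm

theorem deligneComp_assoc (F : V₁ ⟶ V₂) (F' : V₂ ⟶ V₃) (F'' : V₃ ⟶ V₄) (G : W₁ ⟶ W₂)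
    (G' : W₂ ⟶ W₃) (G'' : W₃ ⟶ W₄) :
    deligneMap₂ (α_ F F' F'').hom (α_ G G' G'').hom =
      (deligneComp (F ≫ F') F'' (G ≫ G') G'').hom ≫
        (deligneComp F F' G G').hom ▷ deligneMap F'' G'' ≫
          (α_ (deligneMap F G) (deligneMap F' G') (deligneMap F'' G'')).hom ≫
            deligneMap F G ◁ (deligneComp F' F'' G' G'').inv ≫
              (deligneComp F (F' ≫ F'') G (G' ≫ G'')).inv :=
  hom_eq fun (M : Mat_ (Tens V₁.carrier W₁.carrier)) => by
    let N := (deligneMap F G ≫ deligneMap F' G').functor.obj M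
    refine (deligneMap₂_eq_id (F := F ≫ F' ≫ F'') (G := G ≫ G' ≫ G'') M).trans ?_
    change 𝟙 _ = 𝟙 _ ≫ (deligneMap F'' G'').functor.map (𝟙 N) ≫ 𝟙 _ ≫ 𝟙 _ ≫ 𝟙 _
    rw [CategoryTheory.Functor.map_id]
    simp only [Category.comp_id]

theorem deligneComp_leftUnitor (F : V₁ ⟶ V₂) (G : W₁ ⟶ W₂) :
    deligneMap₂ (λ_ F).hom (λ_ G).hom =
      (deligneComp (𝟙 V₁) F (𝟙 W₁) G).hom ≫ (deligneId V₁ W₁).hom ▷ deligneMap F G ≫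
        (λ_ (deligneMap F G)).hom :=
  hom_eq fun (M : Mat_ (Tens V₁.carrier W₁.carrier)) => by
    refine (deligneMap₂_eq_id (F := F) (G := G) M).trans ?_
    change 𝟙 _ = 𝟙 _ ≫ (tensFunctor F.functor G.functor).mapMat_.map (𝟙 M) ≫ 𝟙 _
    rw [CategoryTheory.Functor.map_id]
    simp only [Category.comp_id]

theorem deligneComp_rightUnitor (F : V₁ ⟶ V₂) (G : W₁ ⟶ W₂) :
    deligneMap₂ (ρ_ F).hom (ρ_ G).hom =
      (deligneComp F (𝟙 V₂) G (𝟙 W₂)).hom ≫ deligneMap F G ◁ (deligneId V₂ W₂).hom ≫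
        (ρ_ (deligneMap F G)).hom :=
  hom_eq fun (M : Mat_ (Tens V₁.carrier W₁.carrier)) => by
    refine (deligneMap₂_eq_id (F := F) (G := G) M).trans ?_
    change 𝟙 _ = 𝟙 _ ≫ 𝟙 _ ≫ 𝟙 _
    simp only [Category.comp_id]

end Coherence

/-- The tensor product `P ⊠ Q` of two theories. -/
def tensorTheory {B : Type u} [Bicategory.{w, v} B] (P Q : B ⥤ᵖ TwoVect) : B ⥤ᵖ TwoVect where
  obj b := deligne (P.obj b) (Q.obj b)
  map f := deligneMap (P.map f) (Q.map f)
  map₂ a := deligneMap₂ (P.map₂ a) (Q.map₂ a)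
  map₂_id f := by rw [P.map₂_id, Q.map₂_id, deligneMap₂_id]
  map₂_comp a b := by rw [P.map₂_comp, Q.map₂_comp, deligneMap₂_comp]
  mapId b := deligneMap₂Iso (P.mapId b) (Q.mapId b) ≪≫ deligneId _ _
  mapComp f g := deligneMap₂Iso (P.mapComp f g) (Q.mapComp f g) ≪≫ deligneComp _ _ _ _
  map₂_whisker_left f g h a := by
    rw [P.map₂_whisker_left, Q.map₂_whisker_left, deligneMap₂_comp, deligneMap₂_comp,
      deligneComp_whiskerLeft]
    simp
  map₂_whisker_right a h := by
    rw [P.map₂_whisker_right, Q.map₂_whisker_right, deligneMap₂_comp, deligneMap₂_comp,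
      deligneComp_whiskerRight]
    simp
  map₂_associator f g h := by
    rw [P.map₂_associator, Q.map₂_associator]
    simp only [deligneMap₂_comp, deligneComp_whiskerLeft, deligneComp_whiskerRight,
      deligneComp_assoc, Iso.trans_hom, Iso.trans_inv, deligneMap₂Iso_hom, deligneMap₂Iso_inv,
      comp_whiskerRight, whiskerLeft_comp, Category.assoc, Iso.inv_hom_id_assoc]
  map₂_left_unitor f := by
    rw [P.map₂_left_unitor, Q.map₂_left_unitor]
    simp only [deligneMap₂_comp, deligneComp_whiskerRight,
      deligneComp_leftUnitor, Iso.trans_hom, deligneMap₂Iso_hom,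
      comp_whiskerRight, Category.assoc, Iso.inv_hom_id_assoc]
  map₂_right_unitor f := by
    rw [P.map₂_right_unitor, Q.map₂_right_unitor]
    simp only [deligneMap₂_comp, deligneComp_whiskerLeft,
      deligneComp_rightUnitor, Iso.trans_hom, deligneMap₂Iso_hom,
      whiskerLeft_comp, Category.assoc, Iso.inv_hom_id_assoc]

/-- The trivial theory: the constant pseudofunctor at the category of vector spaces. -/
def trivialTheory (B : Type u) [Bicategory.{w, v} B] : B ⥤ᵖ TwoVect where
  obj _ := vect
  map _ := 𝟙 vect
  map₂ _ := 𝟙 (𝟙 vect)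
  mapId _ := Iso.refl _
  mapComp _ _ := (λ_ (𝟙 vect)).symm
  map₂_associator f g h := by
    simp only [unitors_equal, Iso.symm_hom, Iso.symm_inv]
    bicategory
  map₂_right_unitor f := by
    simp

/-- A theory `P` is invertible if there is a theory `Q` such that `P ⊠ Q` is equivalent to the
trivial theory (through a natural 2-isomorphism, that is, an equivalence in the bicategory of
pseudofunctors, strong transformations and modifications). -/
def IsInvertible {B : Type u} [Bicategory.{w, v} B] (P : B ⥤ᵖ TwoVect) : Prop :=
  ∃ Q : B ⥤ᵖ TwoVect, Nonempty (Bicategory.Equivalence (tensorTheory P Q) (trivialTheory B))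

/-- The truncation `tr P`: the restriction of `P` to the sub-bicategory `Pith B` of `B` which
contains all objects, all 1-morphisms and only the invertible 2-morphisms. -/
def truncation {B : Type u} [Bicategory.{w, v} B] (P : B ⥤ᵖ TwoVect) : Pith B ⥤ᵖ TwoVect :=
  (Pith.inclusion B).comp P

/-- An anomalous theory with anomaly `P`: a natural 2-transformation `A : 1 ⇒ tr P`, with components
`A_f : P(f) ∘ A_a ⇒ A_b` which need not be invertible. -/
abbrev AnomalousTheory {B : Type u} [Bicategory.{w, v} B] (P : B ⥤ᵖ TwoVect) :=
  (trivialTheory (Pith B)).toLax ⟶ (truncation P).toLax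

theorem restrict_aux {C : Type u} [Bicategory.{w, v} C] {x y x' z : C} {p : x ⟶ y}
    {p' : x' ⟶ z} {r : y ⟶ z} {m m' : y ⟶ z} {k : x ⟶ x'} {n : p ≫ m ⟶ k ≫ p'}
    {n' : p ≫ m' ⟶ k ≫ p'} {i : r ⟶ m} {j : m ⟶ m} {β : m ⟶ m'} {t : p ≫ r ⟶ k ≫ p'}
    (h : n ≫ 𝟙 k ▷ p' = p ◁ β ≫ n') (hj : j = 𝟙 m) (h' : p ◁ (i ≫ j) ≫ n = t) :
    p ◁ (i ≫ β) ≫ n' = t := by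
  subst hj
  simpa [← h] using h'

/-- The restriction of an anomalous theory along a 2-functor from a category. -/
def AnomalousTheory.restrict {B : Type u} [Bicategory.{w, v} B] {P : B ⥤ᵖ TwoVect}
    (A : AnomalousTheory P) {G : Type*} [Category* G] (L : LocallyDiscrete G ⥤ᵖ B) :
    (trivialTheory (LocallyDiscrete G)).toLax ⟶ (L.comp P).toLax where
  app a := A.app ⟨L.obj a⟩
  naturality f := A.naturality (⟨L.map f⟩ : (⟨L.obj _⟩ : Pith B) ⟶ ⟨L.obj _⟩)
  naturality_naturality {a b f g} η := by
    have h := A.naturality_naturality (a := ⟨L.obj a⟩) (b := ⟨L.obj b⟩) (f := ⟨L.map f⟩)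
      (g := ⟨L.map g⟩) (CoreHom.mk (asIso (L.map₂ η)))
    exact h
  naturality_id a :=
    restrict_aux (β := P.map₂ (L.mapId a).inv)
      (A.naturality_naturality (a := ⟨L.obj a⟩) (b := ⟨L.obj a⟩) (f := 𝟙 _)
        (g := ⟨L.map (𝟙 a)⟩) (CoreHom.mk (L.mapId a).symm))
      (P.map₂_id _) (A.naturality_id ⟨L.obj a⟩)
  naturality_comp {a b c} f g :=
    restrict_aux (β := P.map₂ (L.mapComp f g).inv)
      (A.naturality_naturality (a := ⟨L.obj a⟩) (b := ⟨L.obj c⟩)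
        (f := (⟨L.map f⟩ : (⟨L.obj a⟩ : Pith B) ⟶ ⟨L.obj b⟩) ≫ ⟨L.map g⟩)
        (g := ⟨L.map (f ≫ g)⟩) (CoreHom.mk (L.mapComp f g).symm))
      (P.map₂_id _) (A.naturality_comp (⟨L.map f⟩ : (⟨L.obj a⟩ : Pith B) ⟶ ⟨L.obj b⟩) ⟨L.map g⟩)

/-- A strong transformation of pseudofunctors, regarded as a lax transformation. -/
def laxOfStrong {B : Type u} [Bicategory.{w, v} B] {C : Type u'} [Bicategory.{w', v'} C]
    {P Q : B ⥤ᵖ C} (η : P ⟶ Q) : P.toLax ⟶ Q.toLax where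
  app a := η.app a
  naturality f := (η.naturality f).inv
  naturality_naturality {a b f g} β := by
    change (η.naturality f).inv ≫ P.map₂ β ▷ η.app b = η.app a ◁ Q.map₂ β ≫ (η.naturality g).inv
    rw [Iso.inv_comp_eq, ← Category.assoc, Iso.eq_comp_inv, η.naturality_naturality]
  naturality_id a := by
    have h : η.naturality (𝟙 a) ≪≫ whiskerLeftIso (η.app a) (Q.mapId a) =
        whiskerRightIso (P.mapId a) (η.app a) ≪≫ λ_ (η.app a) ≪≫ (ρ_ (η.app a)).symm :=
      Iso.ext (η.naturality_id a)
    exact (congrArg Iso.inv h).trans (Category.assoc _ _ _)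
  naturality_comp {a b c} f g := by
    have h : η.naturality (f ≫ g) ≪≫ whiskerLeftIso (η.app a) (Q.mapComp f g) =
        whiskerRightIso (P.mapComp f g) (η.app c) ≪≫ α_ _ _ _ ≪≫
          whiskerLeftIso (P.map f) (η.naturality g) ≪≫ (α_ _ _ _).symm ≪≫
            whiskerRightIso (η.naturality f) (Q.map g) ≪≫ α_ _ _ _ :=
      Iso.ext (η.naturality_comp f g)
    refine (congrArg Iso.inv h).trans ?_
    simp
    rfl

/-- Multiplication by a non-zero scalar. -/
@[simps]
def scalarIso (c : ℂˣ) : 𝟙 vect ≅ 𝟙 vect where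
  hom := LinFun.Hom.mk (F := 𝟙 vect) (G := 𝟙 vect) { app := fun X => (c : ℂ) • 𝟙 X }
  inv := LinFun.Hom.mk (F := 𝟙 vect) (G := 𝟙 vect) { app := fun X => ((c⁻¹ : ℂˣ) : ℂ) • 𝟙 X }
  hom_inv_id := hom_eq fun X => by
    change ((c : ℂ) • 𝟙 X) ≫ (((c⁻¹ : ℂˣ) : ℂ) • 𝟙 X) = 𝟙 X
    rw [Linear.smul_comp, Linear.comp_smul, smul_smul, Category.id_comp, Units.mul_inv, one_smul]
  inv_hom_id := hom_eq fun X => by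
    change (((c⁻¹ : ℂˣ) : ℂ) • 𝟙 X) ≫ ((c : ℂ) • 𝟙 X) = 𝟙 X
    rw [Linear.smul_comp, Linear.comp_smul, smul_smul, Category.id_comp, Units.inv_mul, one_smul]

section Cocycle
variable (G : Type u) [Groupoid.{v} G]

/-- A 2-cocycle `α_{g₂,g₁}` of a groupoid with values in `ℂˣ`, that is, a 2-functor from the
groupoid to `B²ℂˣ`. Recall that `g₁ ≫ g₂` is the composite `g₂ ∘ g₁`. -/
structure TwoCocycle where
  val {X Y Z : G} (g₂ : Y ⟶ Z) (g₁ : X ⟶ Y) : ℂˣ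
  cocycle {W X Y Z : G} (g₁ : W ⟶ X) (g₂ : X ⟶ Y) (g₃ : Y ⟶ Z) :
    val (g₂ ≫ g₃) g₁ * val g₃ g₂ = val g₃ (g₁ ≫ g₂) * val g₂ g₁

variable {G}

/-- Two 2-cocycles agree up to a coboundary. -/
def TwoCocycle.Cohomologous (α α' : TwoCocycle G) : Prop :=
  ∃ σ : ∀ {X Y : G}, (X ⟶ Y) → ℂˣ, ∀ {X Y Z : G} (g₁ : X ⟶ Y) (g₂ : Y ⟶ Z),
    σ (g₁ ≫ g₂) * α'.val g₂ g₁ = α.val g₂ g₁ * σ g₁ * σ g₂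

theorem TwoCocycle.id_val (α : TwoCocycle G) {X Y : G} (g : X ⟶ Y) :
    α.val (𝟙 Y) g = α.val (𝟙 Y) (𝟙 Y) := by
  have h := α.cocycle g (𝟙 Y) (𝟙 Y)
  simp only [Category.comp_id] at h
  exact (mul_left_cancel h).symm

theorem TwoCocycle.val_id (α : TwoCocycle G) {X Y : G} (g : X ⟶ Y) :
    α.val g (𝟙 X) = α.val (𝟙 X) (𝟙 X) := by
  have h := α.cocycle (𝟙 X) (𝟙 X) g
  simp only [Category.id_comp] at h
  exact mul_left_cancel h

theorem assoc_aux {C : Type u} [Bicategory.{w, v} C] {x : C} (s₁ s₂ s₃ s₄ : 𝟙 x ≅ 𝟙 x) :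
    (s₁.symm ≪≫ (λ_ (𝟙 x)).symm).hom ≫ (s₂.symm ≪≫ (λ_ (𝟙 x)).symm).hom ▷ 𝟙 x ≫
      (α_ (𝟙 x) (𝟙 x) (𝟙 x)).hom ≫ 𝟙 x ◁ (s₃.symm ≪≫ (λ_ (𝟙 x)).symm).inv ≫
        (s₄.symm ≪≫ (λ_ (𝟙 x)).symm).inv = s₁.inv ≫ s₂.inv ≫ s₃.hom ≫ s₄.hom := by
  simp [unitors_inv_equal, unitors_equal]

theorem left_aux {C : Type u} [Bicategory.{w, v} C] {x : C} (s₁ s₂ : 𝟙 x ≅ 𝟙 x) :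
    (s₁.symm ≪≫ (λ_ (𝟙 x)).symm).hom ≫ s₂.hom ▷ 𝟙 x ≫ (λ_ (𝟙 x)).hom = s₁.inv ≫ s₂.hom := by
  simp [unitors_inv_equal, unitors_equal]

theorem right_aux {C : Type u} [Bicategory.{w, v} C] {x : C} (s₁ s₂ : 𝟙 x ≅ 𝟙 x) :
    (s₁.symm ≪≫ (λ_ (𝟙 x)).symm).hom ≫ 𝟙 x ◁ s₂.hom ≫ (ρ_ (𝟙 x)).hom = s₁.inv ≫ s₂.hom := by
  simp [unitors_inv_equal, unitors_equal]

theorem id_aux {C : Type u} [Bicategory.{w, v} C] {x : C} {p : x ⟶ x} (i : 𝟙 x ⟶ 𝟙 x)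
    (n : p ⟶ p) (h : (ρ_ p).inv ≫ p ◁ i ≫ (ρ_ p).hom ≫ n = 𝟙 p) :
    p ◁ i ≫ (ρ_ p).hom ≫ n ≫ (λ_ p).inv = (ρ_ p).hom ≫ (λ_ p).inv ≫ 𝟙 (𝟙 x) ▷ p := by
  rw [Iso.inv_comp_eq, Category.comp_id] at h
  rw [id_whiskerRight, Category.comp_id]
  simpa using congrArg (· ≫ (λ_ p).inv) h

theorem comp_aux {C : Type u} [Bicategory.{w, v} C] {x : C} {p q r : x ⟶ x} (s : 𝟙 x ≅ 𝟙 x)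
    (n : p ⟶ q) (n' : q ⟶ r) (n'' : p ⟶ r) (h : (ρ_ p).inv ≫ p ◁ s.hom ≫ (ρ_ p).hom ≫ n'' = n ≫ n') :
    p ◁ (s.symm ≪≫ (λ_ (𝟙 x)).symm).inv ≫ (ρ_ p).hom ≫ n'' ≫ (λ_ r).inv =
      (α_ p (𝟙 x) (𝟙 x)).inv ≫ ((ρ_ p).hom ≫ n ≫ (λ_ q).inv) ▷ 𝟙 x ≫ (α_ (𝟙 x) q (𝟙 x)).hom ≫
        𝟙 x ◁ ((ρ_ q).hom ≫ n' ≫ (λ_ r).inv) ≫ (α_ (𝟙 x) (𝟙 x) r).inv ≫ (λ_ (𝟙 x)).hom ▷ r := by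
  rw [Iso.inv_comp_eq] at h
  have : p ◁ (s.symm ≪≫ (λ_ (𝟙 x)).symm).inv ≫ (ρ_ p).hom ≫ n'' ≫ (λ_ r).inv =
    p ◁ (λ_ (𝟙 x)).hom ≫ (p ◁ s.hom ≫ (ρ_ p).hom ≫ n'') ≫ (λ_ r).inv := by simp
  rw [this, h]
  bicategory

theorem smul_vect (c d : ℂ) (X : FGModuleCat.{0} ℂ) :
    (c • 𝟙 X) ≫ (d • 𝟙 X) = (c * d) • 𝟙 X := by
  rw [Linear.smul_comp, Linear.comp_smul, smul_smul, Category.id_comp]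

theorem scalar_aux {a b c d : ℂˣ} (h : d * c = a * b) :
    (scalarIso a).inv ≫ (scalarIso b).inv ≫ (scalarIso c).hom ≫ (scalarIso d).hom =
      𝟙 (𝟙 vect) := by
  refine hom_eq fun (X : FGModuleCat.{0} ℂ) => ?_
  change (((a⁻¹ : ℂˣ) : ℂ) • 𝟙 X) ≫ (((b⁻¹ : ℂˣ) : ℂ) • 𝟙 X) ≫ ((c : ℂ) • 𝟙 X) ≫
    ((d : ℂ) • 𝟙 X) = 𝟙 X
  rw [smul_vect, smul_vect, smul_vect, ← Units.val_mul, ← Units.val_mul, ← Units.val_mul]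
  have : a⁻¹ * (b⁻¹ * (c * d)) = 1 := by
    rw [mul_comm c d, h, mul_comm a b, inv_mul_cancel_left, inv_mul_cancel]
  rw [this, Units.val_one, one_smul]

/-- A 2-cocycle as a 2-functor to 2-vector spaces, through `B²ℂˣ ⊂ 2Vect`: all objects are sent to
`vect`, all morphisms to the identity functor, and `α(g₂) ∘ α(g₁) ⇒ α(g₂ ∘ g₁)` is multiplication
by `α_{g₂,g₁}`. -/
def TwoCocycle.toTwoVect (α : TwoCocycle G) : LocallyDiscrete G ⥤ᵖ TwoVect :=
  pseudofunctorOfIsLocallyDiscrete (obj := fun _ => vect) (map := fun _ => 𝟙 vect)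
    (mapId := fun X => scalarIso (α.val (𝟙 X.as) (𝟙 X.as)))
    (mapComp := fun f g => (scalarIso (α.val g.as f.as)).symm ≪≫ (λ_ (𝟙 vect)).symm)
    (map₂_associator := fun f g h => by
      rw [eqToHom_refl]
      exact (assoc_aux _ _ _ _).trans (scalar_aux (α.cocycle f.as g.as h.as)))
    (map₂_left_unitor := fun {X Y} f => by
      rw [eqToHom_refl]
      refine (left_aux _ _).trans ?_
      change (scalarIso (α.val f.as (𝟙 X.as))).inv ≫ _ = _
      rw [α.val_id]
      exact Iso.inv_hom_id _)
    (map₂_right_unitor := fun {X Y} f => by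
      rw [eqToHom_refl]
      refine (right_aux _ _).trans ?_
      change (scalarIso (α.val (𝟙 Y.as) f.as)).inv ≫ _ = _
      rw [α.id_val]
      exact Iso.inv_hom_id _)

/-- A projective representation of a groupoid twisted by a 2-cocycle. -/
structure ProjRep (α : TwoCocycle G) where
  V : G → FGModuleCat.{0} ℂ
  ρ {X Y : G} (g : X ⟶ Y) : V X ⟶ V Y
  ρ_id (X : G) : ρ (𝟙 X) = (α.val (𝟙 X) (𝟙 X) : ℂ) • 𝟙 (V X)
  ρ_comp {X Y Z : G} (g₁ : X ⟶ Y) (g₂ : Y ⟶ Z) :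
    ρ g₁ ≫ ρ g₂ = (α.val g₂ g₁ : ℂ) • ρ (g₁ ≫ g₂)

open MonoidalCategory in
/-- The functor `– ⊗ V`. -/
def tensorWith (V : FGModuleCat.{0} ℂ) : vect ⟶ vect :=
  LinFun.mk (V := vect) (W := vect) (tensorRight (C := FGModuleCat.{0} ℂ) V)
    (additive := inferInstanceAs (tensorRight (C := FGModuleCat.{0} ℂ) V).Additive)
    (linear := inferInstanceAs ((tensorRight (C := FGModuleCat.{0} ℂ) V).Linear ℂ))

open MonoidalCategory in
/-- The natural transformation `– ⊗ f`. -/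
def tensorWithMap {V W : FGModuleCat.{0} ℂ} (f : V ⟶ W) : tensorWith V ⟶ tensorWith W :=
  LinFun.Hom.mk (F := tensorWith V) (G := tensorWith W)
    ((tensoringRight (FGModuleCat.{0} ℂ)).map f)

theorem tensorWithMap_comp {U V W : FGModuleCat.{0} ℂ} (f : U ⟶ V) (g : V ⟶ W) :
    tensorWithMap f ≫ tensorWithMap g = tensorWithMap (f ≫ g) :=
  hom_eq fun (X : FGModuleCat.{0} ℂ) => (MonoidalCategory.whiskerLeft_comp X f g).symm

theorem tensorWithMap_id (V : FGModuleCat.{0} ℂ) :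
    tensorWithMap (𝟙 V) = 𝟙 (tensorWith V) :=
  hom_eq fun (X : FGModuleCat.{0} ℂ) => MonoidalCategory.whiskerLeft_id X V

theorem smul_tensorWithMap (c : ℂ) {V W : FGModuleCat.{0} ℂ} (f : V ⟶ W)
    (a : 𝟙 vect ⟶ 𝟙 vect) (ha : ∀ X : FGModuleCat.{0} ℂ, a.nat.app X = c • 𝟙 X) :
    (ρ_ (tensorWith V)).inv ≫ tensorWith V ◁ a ≫ (ρ_ (tensorWith V)).hom ≫ tensorWithMap f =
      tensorWithMap (c • f) :=
  hom_eq fun (X : FGModuleCat.{0} ℂ) => by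
    let Y : FGModuleCat.{0} ℂ := MonoidalCategoryStruct.tensorObj X V
    have h := ha Y
    change 𝟙 Y ≫ a.nat.app Y ≫ 𝟙 Y ≫
      MonoidalCategoryStruct.whiskerLeft X f = MonoidalCategoryStruct.whiskerLeft X (c • f)
    rw [h, MonoidalLinear.whiskerLeft_smul, Category.id_comp]
    let z : Y ⟶ MonoidalCategoryStruct.tensorObj X W := MonoidalCategoryStruct.whiskerLeft X f
    have hz : (c • 𝟙 Y) ≫ 𝟙 Y ≫ z = c • z := by
      rw [Category.id_comp, Linear.smul_comp, Category.id_comp]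
    exact hz

/-- A projective representation as a natural 2-transformation `1 ⇒ α`. -/
def ProjRep.toTrans {α : TwoCocycle G} (ρ : ProjRep α) :
    (trivialTheory (LocallyDiscrete G)).toLax ⟶ α.toTwoVect.toLax where
  app X := tensorWith (ρ.V X.as)
  naturality g := (ρ_ (tensorWith _)).hom ≫ tensorWithMap (ρ.ρ g.as) ≫ (λ_ (tensorWith _)).inv
  naturality_naturality {X Y f g} η := by
    obtain rfl := obj_ext_of_isDiscrete η
    have h (n : tensorWith (ρ.V X.as) ≫ 𝟙 vect ⟶ 𝟙 vect ≫ tensorWith (ρ.V Y.as)) :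
        n ≫ 𝟙 (𝟙 vect) ▷ tensorWith (ρ.V Y.as) = tensorWith (ρ.V X.as) ◁ 𝟙 (𝟙 vect) ≫ n := by
      simp
    exact h _
  naturality_id X :=
    id_aux (scalarIso (α.val (𝟙 X.as) (𝟙 X.as))).inv (tensorWithMap (ρ.ρ (𝟙 X.as))) (by
      rw [smul_tensorWithMap ((α.val (𝟙 X.as) (𝟙 X.as))⁻¹ : ℂˣ) _ _ fun _ => rfl, ρ.ρ_id, smul_smul,
        Units.inv_mul, one_smul, tensorWithMap_id])
  naturality_comp f g :=
    comp_aux (scalarIso (α.val g.as f.as)) (tensorWithMap (ρ.ρ f.as)) (tensorWithMap (ρ.ρ g.as))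
      (tensorWithMap (ρ.ρ (f.as ≫ g.as))) (by
        rw [tensorWithMap_comp, ρ.ρ_comp]
        exact smul_tensorWithMap _ _ _ fun _ => rfl)

end Cocycle

end AnomalousQFT

end

open AnomalousQFT

/-! Invertibility makes each category `𝒜(X)` equivalent to vector spaces. If `P(X) ⊠ Q(X)` is
equivalent to `vect`, fix a simple object `T` of `Q(X)`: the objects `S i ⊠ T` have one-dimensional
endomorphism spaces and go to lines in `vect`. Since nonzero maps exist between any two lines but
not between non-isomorphic simples, `P(X)` has exactly one simple object
(`exists_isSimpleGenerator`).

The working notion is that of a simple generator `S`: its endomorphisms are scalars and every object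
is a summand of a power of `S`. A natural transformation between linear functors out of such a
category is determined by its component at `S`, and that component can be arbitrary (`natTrans_ext`,
`exists_natTrans`). So 2-cells become single morphisms, and coherence equations need to be checked
only at `S`.

For existence of the cocycle, choose a simple generator `S X` in each value. As the source is a
groupoid, each `P(f)` is an equivalence, so `P(f)` applied to `S X` is isomorphic to `S Y`; choose
such isomorphisms. They respect composition up to nonzero scalars, and associativity says that these
scalars form a 2-cocycle (`exists_framing`). The 2-functor of that cocycle has a tautological
framing, and 2-functors framed by the same cocycle are equivalent (`Framing.nonempty_equivalence`).

For uniqueness, evaluate an equivalence between two cocycle theories at `ℂ`. Its naturality 2-cells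
become nonzero scalars `σ`, and its composition axiom is the coboundary relation
(`cohomologous_of_equivalence`).

For representations, evaluate a transformation `1 ⇒ α` at `ℂ`: its components give vector spaces,
its 2-cells give linear maps, and its axioms are those of a twisted representation, which recovers
the transformation up to isomorphism (`ProjRep.nonempty_iso_ofTrans`). A transformation into `𝒜 ∘ ℓ`
is first carried to `α` along the inverse of the given equivalence (`exists_projRep`). -/

noncomputable section

namespace AnomalousQFT

/-! ### Simple generators and the equivalence `Hom(S, –)` with vector spaces -/

section Generators
variable {C : Type*} [Category.{0} C] [Preadditive C] [Linear ℂ C]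

/-- An object `S` with `End S = ℂ` such that every object is a summand of a power of `S`. -/
structure IsSimpleGenerator (S : C) : Prop where
  exists_smul (f : S ⟶ S) : ∃ c : ℂ, f = c • 𝟙 S
  id_ne_zero : 𝟙 S ≠ 0
  decomp (X : C) : ∃ (m : ℕ) (π : Fin m → (X ⟶ S)) (ι : Fin m → (S ⟶ X)),
    ∑ k, π k ≫ ι k = 𝟙 X

namespace IsSimpleGenerator
variable {S : C} (hS : IsSimpleGenerator S)
include hS

/-- Schur's lemma: `q.inv ≫ p.hom` is an endomorphism of `S`, hence a scalar, and a zero scalar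
would force `𝟙 S = 0`. All cocycle and coboundary scalars below come from this. -/
theorem exists_units_smul {T : C} (p q : T ≅ S) : ∃ c : ℂˣ, p.hom = (c : ℂ) • q.hom := by
  obtain ⟨c, hc⟩ := hS.exists_smul (q.inv ≫ p.hom)
  have h : p.hom = c • q.hom := by
    rw [← Iso.hom_inv_id_assoc q p.hom, hc, Linear.comp_smul, Category.comp_id]
  refine ⟨Units.mk0 c fun h0 => hS.id_ne_zero ?_, h⟩
  rw [← p.inv_hom_id, h, h0, zero_smul, comp_zero]

theorem smul_hom_injective {T : C} (p : T ≅ S) {c d : ℂ} (h : c • p.hom = d • p.hom) : c = d := by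
  have h' : c • 𝟙 S = d • 𝟙 S := by
    have := congrArg (p.inv ≫ ·) h
    simpa using this
  rw [← sub_eq_zero, ← sub_smul] at h'
  exact sub_eq_zero.1 ((smul_eq_zero.1 h').resolve_right hS.id_ne_zero)

omit hS [Linear ℂ C] in
theorem sum_comp_eq {X Y : C} {m : ℕ} {π : Fin m → (X ⟶ S)} {ι : Fin m → (S ⟶ X)}
    (h : ∑ k, π k ≫ ι k = 𝟙 X) (f : X ⟶ Y) : f = ∑ k, π k ≫ ι k ≫ f := by
  simp_rw [← Category.assoc, ← Preadditive.sum_comp, h, Category.id_comp]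

theorem hom_ext {X Y : C} {f g : X ⟶ Y} (h : ∀ u : S ⟶ X, u ≫ f = u ≫ g) : f = g := by
  obtain ⟨m, π, ι, hX⟩ := hS.decomp X
  rw [sum_comp_eq hX f, sum_comp_eq hX g]
  simp_rw [h]

variable {D : Type*} [Category.{0} D] [Preadditive D]

/-- Splitting `𝟙 X` through copies of `S` and using naturality expresses `a.app X` as the sum of
`F(π k) ≫ a.app S ≫ G(ι k)`. -/
theorem natTrans_ext {F G : C ⥤ D} [F.Additive] {a b : F ⟶ G}
    (h : a.app S = b.app S) : a = b := by
  ext X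
  obtain ⟨m, π, ι, hX⟩ := hS.decomp X
  have e (a : F ⟶ G) : a.app X = ∑ k, F.map (π k) ≫ a.app S ≫ G.map (ι k) := by
    simp_rw [← a.naturality, ← Category.assoc, ← F.map_comp, ← Preadditive.sum_comp,
      ← F.map_sum, hX, F.map_id, Category.id_comp]
  rw [e a, e b, h]

/-- The formula that proves uniqueness also defines the extension. Naturality reduces to
endomorphisms of `S`; these are scalars, which linear functors preserve and which therefore commute
with `a`. -/
theorem exists_natTrans [Linear ℂ D] (F G : C ⥤ D) [F.Additive] [F.Linear ℂ] [G.Additive] [G.Linear ℂ]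
    (a : F.obj S ⟶ G.obj S) : ∃ b : F ⟶ G, b.app S = a := by
  choose m π ι hX using hS.decomp
  have comm (f : S ⟶ S) : F.map f ≫ a = a ≫ G.map f := by
    obtain ⟨c, rfl⟩ := hS.exists_smul f
    simp [Functor.map_smul]
  have key {X Y : C} (f : X ⟶ Y) :
      F.map f ≫ ∑ k, F.map (π Y k) ≫ a ≫ G.map (ι Y k) =
        (∑ k, F.map (π X k) ≫ a ≫ G.map (ι X k)) ≫ G.map f := by
    -- Between the chosen splittings of `X` and `Y`, the morphism `f` is a matrix of endomorphisms
    -- of `S`; `a` commutes with each entry.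
    have h (k : Fin (m X)) (l : Fin (m Y)) :
        F.map (ι X k) ≫ F.map f ≫ F.map (π Y l) ≫ a =
          a ≫ G.map (ι X k) ≫ G.map f ≫ G.map (π Y l) := by
      simpa using comm (ι X k ≫ f ≫ π Y l)
    rw [Preadditive.sum_comp, Preadditive.comp_sum]
    calc ∑ l, F.map f ≫ F.map (π Y l) ≫ a ≫ G.map (ι Y l)
        = ∑ l, ∑ k, F.map (π X k) ≫ (F.map (ι X k) ≫ F.map f ≫ F.map (π Y l) ≫ a) ≫
            G.map (ι Y l) := by
          refine Finset.sum_congr rfl fun l _ => ?_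
          conv_lhs => rw [sum_comp_eq (hX X) f, F.map_sum, Preadditive.sum_comp]
          simp
      _ = ∑ k, ∑ l, F.map (π X k) ≫ a ≫ G.map (ι X k) ≫ G.map f ≫ G.map (π Y l) ≫
            G.map (ι Y l) := by
          rw [Finset.sum_comm]
          simp_rw [h, Category.assoc]
      _ = ∑ k, (F.map (π X k) ≫ a ≫ G.map (ι X k)) ≫ G.map f := by
          refine Finset.sum_congr rfl fun k _ => ?_
          simp_rw [← G.map_comp, ← Preadditive.comp_sum, ← G.map_sum, ← Preadditive.comp_sum, hX Y]
          simp
  refine ⟨⟨fun X => ∑ k, F.map (π X k) ≫ a ≫ G.map (ι X k), fun X Y f => key f⟩, ?_⟩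
  -- The splitting chosen for `S` itself need not be the trivial one; `comm` moves `a` to the front
  -- so that the sum collapses to an identity.
  change ∑ k, F.map (π S k) ≫ a ≫ G.map (ι S k) = a
  simp_rw [← Category.assoc, comm, Category.assoc, ← Preadditive.comp_sum, ← G.map_comp,
    ← G.map_sum, hX S, G.map_id, Category.comp_id]

/-- Scalars as endomorphisms of a simple generator. -/
def scalarEquiv : ℂ ≃ₗ[ℂ] (S ⟶ S) :=
  LinearEquiv.ofBijective (LinearMap.toSpanSingleton ℂ _ (𝟙 S))
    ⟨fun _ _ h => hS.smul_hom_injective (Iso.refl S) h,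
      fun f => (hS.exists_smul f).imp fun _ h => h.symm⟩

theorem scalarEquiv_symm_smul (f : S ⟶ S) : hS.scalarEquiv.symm f • 𝟙 S = f :=
  hS.scalarEquiv.apply_symm_apply f

/-- The inclusions `ι k` span: `u` is the sum of `(u ≫ π k) ≫ ι k`, and each `u ≫ π k` is a scalar.
-/
theorem finite_hom (X : C) : Module.Finite ℂ (S ⟶ X) := by
  obtain ⟨m, π, ι, hX⟩ := hS.decomp X
  classical
  refine ⟨⟨Finset.univ.image ι, ?_⟩⟩
  rw [eq_top_iff]
  rintro u -
  have : u = ∑ k, hS.scalarEquiv.symm (u ≫ π k) • ι k := by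
    have h (k) : hS.scalarEquiv.symm (u ≫ π k) • ι k = u ≫ π k ≫ ι k := by
      have := congrArg (· ≫ ι k) (hS.scalarEquiv_symm_smul (u ≫ π k))
      simpa using this
    simp_rw [h, ← Preadditive.comp_sum, hX, Category.comp_id]
  rw [this]
  exact Submodule.sum_mem _ fun k _ => Submodule.smul_mem _ _ (Submodule.subset_span (by simp))

/-- The functor `Hom(S, –)`. -/
def homFunctor : C ⥤ FGModuleCat.{0} ℂ where
  obj X := haveI := hS.finite_hom X; FGModuleCat.of ℂ (S ⟶ X)
  map {X Y} f := haveI := hS.finite_hom X; haveI := hS.finite_hom Y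
    FGModuleCat.ofHom (Linear.rightComp ℂ S f)
  map_id X := by ext u; exact Category.comp_id (u : S ⟶ X)
  map_comp f g := by
    ext u
    exact (Category.assoc (u : S ⟶ _) f g).symm

instance : hS.homFunctor.Additive where
  map_add {X Y f g} := by
    ext u
    exact Preadditive.comp_add _ _ _ (u : S ⟶ X) f g

instance : hS.homFunctor.Linear ℂ where
  map_smul {X Y} f r := by
    ext u
    exact Linear.comp_smul S X Y (u : S ⟶ X) r f

instance : hS.homFunctor.Faithful where
  map_injective {X Y _ _} h := hS.hom_ext fun u =>
    congrArg (fun a : hS.homFunctor.obj X ⟶ hS.homFunctor.obj Y => a.hom.hom u) h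

/-- A linear map `T` is determined by its values on the spanning family `ι k`, so it is
postcomposition with the sum of `π k ≫ T (ι k)`. -/
instance : hS.homFunctor.Full where
  map_surjective {X Y} a := by
    obtain ⟨m, π, ι, hX⟩ := hS.decomp X
    let T : (S ⟶ X) →ₗ[ℂ] (S ⟶ Y) := a.hom.hom
    have h (u : S ⟶ X) : u ≫ ∑ k, π k ≫ T (ι k) = T u := by
      have hu : u = ∑ k, (u ≫ π k) ≫ ι k := by
        simp_rw [Category.assoc, ← Preadditive.comp_sum, hX, Category.comp_id]
      conv_rhs => rw [hu]
      rw [map_sum, Preadditive.comp_sum]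
      refine Finset.sum_congr rfl fun k _ => ?_
      obtain ⟨c, hc⟩ := hS.exists_smul (u ≫ π k)
      rw [← Category.assoc, hc]
      simp
    exact ⟨∑ k, π k ≫ T (ι k), by ext u; exact h u⟩

/-- Only essential surjectivity is left: a space of dimension `m` is the image of the `m`-fold
biproduct of `S`. -/
theorem isEquivalence_homFunctor [HasFiniteBiproducts C] : hS.homFunctor.IsEquivalence where
  essSurj := ⟨fun V => by
    let b := Module.finBasis ℂ V
    let X : C := ⨁ fun _ : Fin (Module.finrank ℂ V) => S
    let e : (S ⟶ X) ≃ₗ[ℂ] (Fin (Module.finrank ℂ V) → (S ⟶ S)) :=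
      { toFun := fun u k => u ≫ biproduct.π _ k
        invFun := fun f => biproduct.lift f
        map_add' := fun u v => by ext k; simp
        map_smul' := fun c u => by ext k; simp
        left_inv := fun u => by ext; simp
        right_inv := fun f => by ext; simp }
    have := hS.finite_hom X
    let i : (S ⟶ X) ≃ₗ[ℂ] V := e ≪≫ₗ LinearEquiv.piCongrRight (fun _ => hS.scalarEquiv.symm) ≪≫ₗ
      b.equivFun.symm
    exact ⟨X, ⟨i.toFGModuleCatIso⟩⟩⟩

/-- `Hom(S, S) ≅ ℂ`. -/
def homFunctorObjIso : hS.homFunctor.obj S ≅ FGModuleCat.of ℂ ℂ :=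
  haveI := hS.finite_hom S
  hS.scalarEquiv.symm.toFGModuleCatIso

end IsSimpleGenerator

end Generators

theorem finrank_fgModuleCat_hom (V W : FGModuleCat.{0} ℂ) :
    Module.finrank ℂ (V ⟶ W) = Module.finrank ℂ V * Module.finrank ℂ W := by
  let e : (V ⟶ W) ≃ₗ[ℂ] (V →ₗ[ℂ] W) := InducedCategory.homLinearEquiv ≪≫ₗ ModuleCat.homLinearEquiv
  rw [e.finrank_eq, Module.finrank_linearMap]

theorem isSimpleGenerator_complex : IsSimpleGenerator (FGModuleCat.of ℂ ℂ) where
  exists_smul f := ⟨f.hom.hom (1 : ℂ), by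
    ext
    exact (mul_one (f.hom.hom (1 : ℂ) : ℂ)).symm⟩
  id_ne_zero h := by
    have := congrArg (fun f : FGModuleCat.of ℂ ℂ ⟶ FGModuleCat.of ℂ ℂ => f.hom.hom (1 : ℂ)) h
    exact one_ne_zero (α := ℂ) this
  decomp X := by
    let b := Module.finBasis ℂ X
    refine ⟨_, fun k => FGModuleCat.ofHom (b.coord k),
      fun k => FGModuleCat.ofHom (LinearMap.toSpanSingleton ℂ X (b k)), ?_⟩
    let e : (X ⟶ X) ≃ₗ[ℂ] (X →ₗ[ℂ] X) := InducedCategory.homLinearEquiv ≪≫ₗ ModuleCat.homLinearEquiv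
    apply e.injective
    rw [map_sum]
    have h : ∑ k, LinearMap.toSpanSingleton ℂ X (b k) ∘ₗ b.coord k = LinearMap.id := by
      ext x
      simp [b.sum_repr]
    exact h

/-- An object of a category equivalent to `vect` is determined by the dimension of its space of
endomorphisms, if that dimension is one. -/
theorem IsSimpleGenerator.nonempty_iso {C : Type*} [Category.{0} C] [Preadditive C] [Linear ℂ C]
    [HasFiniteBiproducts C] {S : C} (hS : IsSimpleGenerator S) {T : C}
    (hT : Module.finrank ℂ (T ⟶ T) = 1) : Nonempty (T ≅ S) := by
  have := hS.isEquivalence_homFunctor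
  let F := hS.homFunctor
  have e : (T ⟶ T) ≃ₗ[ℂ] (F.obj T ⟶ F.obj T) :=
    LinearEquiv.ofBijective (F.mapLinearMap ℂ) ⟨F.map_injective, F.map_surjective⟩
  -- The dimension of `End (F T)` is the square of that of `F T`, so `F T` is a line, as is the
  -- image of `S`.
  rw [e.finrank_eq, finrank_fgModuleCat_hom] at hT
  have h1 : Module.finrank ℂ (F.obj T) = Module.finrank ℂ ℂ := by
    rw [Module.finrank_self]
    exact Nat.eq_one_of_mul_eq_one_right hT
  let i : F.obj T ≅ FGModuleCat.of ℂ ℂ := (LinearEquiv.ofFinrankEq _ _ h1).toFGModuleCatIso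
  exact ⟨F.preimageIso (i ≪≫ hS.homFunctorObjIso.symm)⟩

/-! ### 2-vector spaces with a simple generator -/

section TwoCells
variable {V W : TwoVect} {S : V.carrier} (hS : IsSimpleGenerator S)
include hS

theorem IsSimpleGenerator.twoCell_ext {F G : V ⟶ W} {a b : F ⟶ G}
    (h : a.nat.app S = b.nat.app S) : a = b :=
  LinFun.Hom.ext (hS.natTrans_ext h)

/-- The 2-cell with a given value at the simple generator. -/
def IsSimpleGenerator.twoCell {F G : V ⟶ W} (a : F.functor.obj S ⟶ G.functor.obj S) : F ⟶ G :=
  LinFun.Hom.mk (hS.exists_natTrans F.functor G.functor a).choose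

theorem IsSimpleGenerator.twoCell_app {F G : V ⟶ W} (a : F.functor.obj S ⟶ G.functor.obj S) :
    (hS.twoCell a).nat.app S = a :=
  (hS.exists_natTrans F.functor G.functor a).choose_spec

/-- The invertible 2-cell with a given value at the simple generator. -/
def IsSimpleGenerator.twoCellIso {F G : V ⟶ W} (a : F.functor.obj S ≅ G.functor.obj S) :
    F ≅ G where
  hom := hS.twoCell a.hom
  inv := hS.twoCell a.inv
  hom_inv_id := hS.twoCell_ext (by
    change (hS.twoCell a.hom).nat.app S ≫ (hS.twoCell a.inv).nat.app S = 𝟙 _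
    rw [hS.twoCell_app, hS.twoCell_app, a.hom_inv_id])
  inv_hom_id := hS.twoCell_ext (by
    change (hS.twoCell a.inv).nat.app S ≫ (hS.twoCell a.hom).nat.app S = 𝟙 _
    rw [hS.twoCell_app, hS.twoCell_app, a.inv_hom_id])

theorem IsSimpleGenerator.twoCellIso_app {F G : V ⟶ W} (a : F.functor.obj S ≅ G.functor.obj S) :
    (hS.twoCellIso a).hom.nat.app S = a.hom :=
  hS.twoCell_app a.hom

/-- `Hom(S, –)` followed by an inverse of `Hom(S', –)` works, because both functors send their
generator to `ℂ`. -/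
theorem IsSimpleGenerator.exists_linFun {S' : W.carrier} (hS' : IsSimpleGenerator S') :
    ∃ H : V ⟶ W, Nonempty (H.functor.obj S ≅ S') := by
  have := hS'.isEquivalence_homFunctor
  let E := hS'.homFunctor.asEquivalence
  have : E.functor.Additive := inferInstanceAs hS'.homFunctor.Additive
  have : E.functor.Linear ℂ := inferInstanceAs (hS'.homFunctor.Linear ℂ)
  have : E.inverse.Additive := inferInstance
  have : E.inverse.Linear ℂ := E.inverseLinear ℂ
  exact ⟨LinFun.mk (hS.homFunctor ⋙ E.inverse),
    ⟨E.inverse.mapIso (hS.homFunctorObjIso ≪≫ hS'.homFunctorObjIso.symm) ≪≫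
      (E.unitIso.app S').symm⟩⟩

end TwoCells

/-! ### Components of 2-cells between 2-vector spaces -/

theorem twoCell_naturality {V W : TwoVect} {F G : V ⟶ W} (a : F ⟶ G) {X Y : V.carrier}
    (f : X ⟶ Y) : F.functor.map f ≫ a.nat.app Y = a.nat.app X ≫ G.functor.map f :=
  a.nat.naturality f

/-- The component of an invertible 2-cell. -/
@[simps]
def appIso {V W : TwoVect} {F G : V ⟶ W} (a : F ≅ G) (X : V.carrier) :
    F.functor.obj X ≅ G.functor.obj X where
  hom := a.hom.nat.app X
  inv := a.inv.nat.app X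
  hom_inv_id := congrArg (fun b : F ⟶ F => b.nat.app X) a.hom_inv_id
  inv_hom_id := congrArg (fun b : G ⟶ G => b.nat.app X) a.inv_hom_id

section Components
variable {B : Type u} [Bicategory.{w, v} B] {P Q R : B ⥤ᵖ TwoVect}

/-- Associators and unitors of `TwoVect` have identity components, so they disappear when a
bicategorical axiom is evaluated at an object. The lemmas below record the axioms in this strict
form. -/
theorem naturality_comp_app (η : P ⟶ Q) {a b c : B} (f : a ⟶ b) (g : b ⟶ c)
    (X : (P.obj a).carrier) :
    (η.naturality (f ≫ g)).hom.nat.app X ≫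
        (Q.mapComp f g).hom.nat.app ((η.app a).functor.obj X) =
      (η.app c).functor.map ((P.mapComp f g).hom.nat.app X) ≫
        (η.naturality g).hom.nat.app ((P.map f).functor.obj X) ≫
          (Q.map g).functor.map ((η.naturality f).hom.nat.app X) := by
  have h := congrArg (fun a => LinFun.Hom.nat a) (η.naturality_comp f g)
  have h' := congrArg (fun a => NatTrans.app a X) h
  refine Eq.trans h' ?_
  let x := (η.app c).functor.map ((P.mapComp f g).hom.nat.app X)
  let y := (η.naturality g).hom.nat.app ((P.map f).functor.obj X)
  let z := (Q.map g).functor.map ((η.naturality f).hom.nat.app X)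
  change x ≫ 𝟙 _ ≫ y ≫ 𝟙 _ ≫ z ≫ 𝟙 _ = x ≫ y ≫ z
  simp only [Category.comp_id, Category.id_comp]

theorem comp_naturality_app (η : P ⟶ Q) (θ : Q ⟶ R) {a b : B} (f : a ⟶ b)
    (X : (P.obj a).carrier) :
    ((η ≫ θ).naturality f).hom.nat.app X =
      (θ.app b).functor.map ((η.naturality f).hom.nat.app X) ≫
        (θ.naturality f).hom.nat.app ((η.app a).functor.obj X) := by
  let x := (θ.app b).functor.map ((η.naturality f).hom.nat.app X)
  let y := (θ.naturality f).hom.nat.app ((η.app a).functor.obj X)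
  change 𝟙 _ ≫ x ≫ 𝟙 _ ≫ y ≫ 𝟙 _ = x ≫ y
  simp only [Category.comp_id, Category.id_comp]

theorem id_naturality_app {a b : B} (f : a ⟶ b) (X : (P.obj a).carrier) :
    (Pseudofunctor.StrongTrans.naturality (𝟙 P) f).hom.nat.app X = 𝟙 ((P.map f).functor.obj X) :=
  (Category.comp_id (𝟙 ((P.map f).functor.obj X)))

theorem mapComp_assoc_app {a b c d : B} (f : a ⟶ b) (g : b ⟶ c) (h : c ⟶ d)
    (X : (P.obj a).carrier) :
    (P.mapComp (f ≫ g) h).hom.nat.app X ≫ (P.map h).functor.map ((P.mapComp f g).hom.nat.app X) =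
      (P.map₂ (α_ f g h).hom).nat.app X ≫ (P.mapComp f (g ≫ h)).hom.nat.app X ≫
        (P.mapComp g h).hom.nat.app ((P.map f).functor.obj X) := by
  have e := congrArg (fun a => LinFun.Hom.nat a) (P.map₂_associator f g h)
  have e' := congrArg (fun a => NatTrans.app a X) e
  let x := (P.mapComp (f ≫ g) h).hom.nat.app X
  let y := (P.map h).functor.map ((P.mapComp f g).hom.nat.app X)
  let z := appIso (P.mapComp g h) ((P.map f).functor.obj X)
  let t := appIso (P.mapComp f (g ≫ h)) X
  change _ = x ≫ y ≫ 𝟙 _ ≫ z.inv ≫ t.inv at e'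
  change x ≫ y = _ ≫ t.hom ≫ z.hom
  erw [e']
  simp

theorem mapComp_id_app {a b : B} (f : a ⟶ b) (X : (P.obj a).carrier) :
    (P.mapComp (𝟙 a) f).hom.nat.app X ≫ (P.map f).functor.map ((P.mapId a).hom.nat.app X) =
      (P.map₂ (λ_ f).hom).nat.app X := by
  have e := congrArg (fun a => LinFun.Hom.nat a) (P.map₂_left_unitor f)
  have e' := congrArg (fun a => NatTrans.app a X) e
  let x := (P.mapComp (𝟙 a) f).hom.nat.app X
  let y := (P.map f).functor.map ((P.mapId a).hom.nat.app X)
  refine Eq.symm (e'.trans ?_)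
  change x ≫ y ≫ 𝟙 _ = x ≫ y
  simp

end Components

/-! ### Framings: 2-functors trivialized up to a 2-cocycle -/

section Framing
variable {G : Type u} [Groupoid.{v} G]

/-- A choice of simple generators of the values of a 2-functor, which are preserved up to chosen
isomorphisms that are multiplicative up to a given 2-cocycle. -/
structure Framing (P : LocallyDiscrete G ⥤ᵖ TwoVect) (α : TwoCocycle G) where
  S (X : LocallyDiscrete G) : (P.obj X).carrier
  gen (X : LocallyDiscrete G) : IsSimpleGenerator (S X)
  φ {X Y : LocallyDiscrete G} (f : X ⟶ Y) : (P.map f).functor.obj (S X) ≅ S Y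
  φ_comp {X Y Z : LocallyDiscrete G} (f : X ⟶ Y) (g : Y ⟶ Z) :
    (α.val g.as f.as : ℂ) • ((P.mapComp f g).hom.nat.app (S X) ≫
      (P.map g).functor.map (φ f).hom ≫ (φ g).hom) = (φ (f ≫ g)).hom

variable {P Q R : LocallyDiscrete G ⥤ᵖ TwoVect} {α : TwoCocycle G}

/-- A 2-cell of a locally discrete bicategory is an identity up to equality of its endpoints. This
removes the images of associators and unitors of the source from the axioms of `P`. -/
theorem map₂_app_comp {X Y : LocallyDiscrete G} {f g : X ⟶ Y} (β : f ⟶ g)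
    {S : (P.obj X).carrier} {T : (P.obj Y).carrier}
    (φ : ∀ f : X ⟶ Y, (P.map f).functor.obj S ⟶ T) :
    (P.map₂ β).nat.app S ≫ φ g = φ f := by
  obtain rfl := obj_ext_of_isDiscrete β
  obtain rfl : β = 𝟙 f := Subsingleton.elim _ _
  rw [P.map₂_id]
  exact Category.id_comp _

/-- A framing prescribes nothing about units, yet the unit constraint is forced: by Schur it is a
multiple of `φ (𝟙 X)`, and the left unit axiom, compared with `φ_comp` at two identities, determines
the factor. -/
theorem Framing.mapId_app (Φ : Framing P α) (X : LocallyDiscrete G) :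
    (P.mapId X).hom.nat.app (Φ.S X) = (α.val (𝟙 X.as) (𝟙 X.as) : ℂ) • (Φ.φ (𝟙 X)).hom := by
  obtain ⟨d, hd⟩ := (Φ.gen X).exists_units_smul (appIso (P.mapId X) (Φ.S X)) (Φ.φ (𝟙 X))
  change (P.mapId X).hom.nat.app (Φ.S X) = _ at hd
  rw [hd]
  congr 1
  have h₁ := mapComp_id_app (P := P) (𝟙 X) (Φ.S X)
  have h₂ := congrArg (· ≫ (Φ.φ (𝟙 X)).hom) h₁
  have h₃ := h₂.trans (map₂_app_comp (λ_ (𝟙 X)).hom fun f => (Φ.φ f).hom)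
  have h₄ := h₃.trans (Φ.φ_comp (𝟙 X) (𝟙 X)).symm
  rw [hd] at h₄
  let i : (P.map (𝟙 X ≫ 𝟙 X)).functor.obj (Φ.S X) ≅ Φ.S X :=
    appIso (P.mapComp (𝟙 X) (𝟙 X)) (Φ.S X) ≪≫ (P.map (𝟙 X)).functor.mapIso (Φ.φ (𝟙 X)) ≪≫
      Φ.φ (𝟙 X)
  refine (Φ.gen X).smul_hom_injective i (Eq.trans ?_ h₄)
  simp [i, Functor.map_smul]

/-- A transformation preserves the chosen simple generators and the isomorphisms between them. -/
structure Framing.Preserves (Φ : Framing P α) (Ψ : Framing Q α) (η : P ⟶ Q)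
    (h : ∀ X, (η.app X).functor.obj (Φ.S X) ≅ Ψ.S X) : Prop where
  naturality_app {X Y : LocallyDiscrete G} (f : X ⟶ Y) :
    (η.naturality f).hom.nat.app (Φ.S X) ≫ (Q.map f).functor.map (h X).hom ≫ (Ψ.φ f).hom =
      (η.app Y).functor.map (Φ.φ f).hom ≫ (h Y).hom

theorem Framing.Preserves.id (Φ : Framing P α) :
    Φ.Preserves Φ (𝟙 P) (fun X => Iso.refl (Φ.S X)) where
  naturality_app {X Y} f := by
    rw [id_naturality_app]
    let x := (Φ.φ f).hom
    change 𝟙 _ ≫ (P.map f).functor.map (𝟙 _) ≫ x = x ≫ 𝟙 _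
    simp

theorem Framing.Preserves.comp {Φ : Framing P α} {Ψ : Framing Q α} {Χ : Framing R α}
    {η : P ⟶ Q} {θ : Q ⟶ R} {h : ∀ X, (η.app X).functor.obj (Φ.S X) ≅ Ψ.S X}
    {h' : ∀ X, (θ.app X).functor.obj (Ψ.S X) ≅ Χ.S X}
    (hη : Φ.Preserves Ψ η h) (hθ : Ψ.Preserves Χ θ h') :
    Φ.Preserves Χ (η ≫ θ) (fun X => (θ.app X).functor.mapIso (h X) ≪≫ h' X) where
  naturality_app {X Y} f := by
    -- The image under `θ.app Y` of the square of `η` and the square of `θ` are glued along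
    -- naturality of the 2-cell `θ.naturality f` at `h X`.
    have paste {D : Type 1} [Category.{0} D] {A₀ A₁ A₂ A₃ A₄ A₅ B₂ C₁ C₂ : D} {a : A₀ ⟶ A₁}
        {b : A₁ ⟶ A₂} {c : A₂ ⟶ A₃} {d : A₃ ⟶ A₄} {e : A₄ ⟶ A₅} {b' : A₁ ⟶ B₂} {c' : B₂ ⟶ A₃}
        {k : B₂ ⟶ C₂} {r : C₂ ⟶ A₅} {p : A₀ ⟶ C₁} {q : C₁ ⟶ C₂} (h₁ : a ≫ b' ≫ k = p ≫ q)
        (h₂ : c' ≫ d ≫ e = k ≫ r) (h₃ : b' ≫ c' = b ≫ c) :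
        (a ≫ b) ≫ (c ≫ d) ≫ e = p ≫ q ≫ r := by
      have h₁' := congrArg (· ≫ r) h₁
      simp only [Category.assoc] at h₁' ⊢
      rw [← h₁', ← h₂, reassoc_of% h₃]
    rw [comp_naturality_app]
    have e₁ := congrArg (fun a => (θ.app Y).functor.map a) (hη.naturality_app f)
    simp only [Functor.map_comp] at e₁
    have e₃ := twoCell_naturality (θ.naturality f).hom (h X).hom
    have e := paste e₁ (hθ.naturality_app f) e₃
    refine Eq.trans ?_ e
    congr 2
    exact (R.map f).functor.map_comp _ _

/-- Two transformations preserving the same framings are isomorphic. -/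
theorem Framing.Preserves.nonempty_iso {Φ : Framing P α} {Ψ : Framing Q α} {η θ : P ⟶ Q}
    {h : ∀ X, (η.app X).functor.obj (Φ.S X) ≅ Ψ.S X}
    {h' : ∀ X, (θ.app X).functor.obj (Φ.S X) ≅ Ψ.S X}
    (hη : Φ.Preserves Ψ η h) (hθ : Φ.Preserves Ψ θ h') : Nonempty (η ≅ θ) := by
  have paste {D : Type 1} [Category.{0} D] {A A' B B' C C' M N : D} {γ : A ⟶ A'} {t : A' ⟶ B'}
      {n : A ⟶ B} {q : B ⟶ M} {q' : B' ≅ M} {ψ : M ≅ N} {p : A ⟶ C} {p' : A' ⟶ C'} {s : C ⟶ N}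
      {s' : C' ≅ N} (h₁ : n ≫ q ≫ ψ.hom = p ≫ s) (h₂ : t ≫ q'.hom ≫ ψ.hom = p' ≫ s'.hom)
      (h₃ : p ≫ s ≫ s'.inv = γ ≫ p') : γ ≫ t = n ≫ q ≫ q'.inv := by
    rw [← cancel_mono (q' ≪≫ ψ).hom]
    simp only [Iso.trans_hom, Category.assoc, Iso.inv_hom_id_assoc, h₁, h₂]
    rw [← Category.assoc, ← h₃]
    simp
  -- At the generator, the modification is `h X` followed by the inverse of `h' X`. Its axiom is
  -- checked only there, where it follows from the two preservation squares.
  refine ⟨Pseudofunctor.StrongTrans.isoMk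
    (fun X => (Φ.gen X).twoCellIso (h X ≪≫ (h' X).symm)) fun {X Y} f => ?_⟩
  refine (Φ.gen X).twoCell_ext ?_
  have e₁ := hη.naturality_app f
  have e₂ := hθ.naturality_app f
  have e₃ := twoCell_naturality ((Φ.gen Y).twoCellIso (h Y ≪≫ (h' Y).symm)).hom (Φ.φ f).hom
  rw [IsSimpleGenerator.twoCellIso_app] at e₃
  refine (paste (q' := (Q.map f).functor.mapIso (h' X)) e₁ e₂ e₃).trans ?_
  change _ = (η.naturality f).hom.nat.app (Φ.S X) ≫ (Q.map f).functor.map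
    (((Φ.gen X).twoCellIso (h X ≪≫ (h' X).symm)).hom.nat.app (Φ.S X))
  rw [IsSimpleGenerator.twoCellIso_app]
  congr 1
  exact ((Q.map f).functor.map_comp _ _).symm

/-- 2-functors with framings for the same 2-cocycle are related by a transformation. -/
theorem Framing.exists_preserves (Φ : Framing P α) (Ψ : Framing Q α) :
    ∃ (η : P ⟶ Q) (h : ∀ X, (η.app X).functor.obj (Φ.S X) ≅ Ψ.S X), Φ.Preserves Ψ η h := by
  choose H h using fun X => (Φ.gen X).exists_linFun (Ψ.gen X)
  replace h := fun X => (h X).some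
  -- The value at the generator is the only one for which the preservation square `hn` commutes.
  let n {X Y : LocallyDiscrete G} (f : X ⟶ Y) : P.map f ≫ H Y ≅ H X ≫ Q.map f :=
    (Φ.gen X).twoCellIso (F := P.map f ≫ H Y) (G := H X ≫ Q.map f)
      ((H Y).functor.mapIso (Φ.φ f) ≪≫ h Y ≪≫ (Ψ.φ f).symm ≪≫ (Q.map f).functor.mapIso (h X).symm)
  have hn {X Y : LocallyDiscrete G} (f : X ⟶ Y) :
      (n f).hom.nat.app (Φ.S X) ≫ (Q.map f).functor.map (h X).hom ≫ (Ψ.φ f).hom =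
        (H Y).functor.map (Φ.φ f).hom ≫ (h Y).hom := by
    have e : (n f).hom.nat.app (Φ.S X) = (H Y).functor.map (Φ.φ f).hom ≫ (h Y).hom ≫
        (Ψ.φ f).inv ≫ (Q.map f).functor.map (h X).inv :=
      (Φ.gen X).twoCellIso_app (F := P.map f ≫ H Y) (G := H X ≫ Q.map f) _
    rw [e]
    simp only [Category.assoc, ← (Q.map f).functor.map_comp_assoc, Iso.inv_hom_id]
    simp
  -- Both unit constraints are the same multiple of the framing isomorphism at the identity, since
  -- the two framings share the cocycle `α`.
  have h_id (X : LocallyDiscrete G) :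
      (n (𝟙 X)).hom.nat.app (Φ.S X) ≫ (Q.mapId X).hom.nat.app ((H X).functor.obj (Φ.S X)) =
        (H X).functor.map ((P.mapId X).hom.nat.app (Φ.S X)) := by
    rw [Φ.mapId_app, ← cancel_mono (h X).hom, Category.assoc]
    have e := twoCell_naturality (Q.mapId X).hom (h X).hom
    rw [Ψ.mapId_app] at e
    refine (congrArg _ e.symm).trans ?_
    have e' := congrArg ((α.val (𝟙 X.as) (𝟙 X.as) : ℂ) • ·) (hn (𝟙 X))
    simpa [Functor.map_smul] using e'
  have h_comp {X Y Z : LocallyDiscrete G} (f : X ⟶ Y) (g : Y ⟶ Z) :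
      (n (f ≫ g)).hom.nat.app (Φ.S X) ≫ (Q.mapComp f g).hom.nat.app ((H X).functor.obj (Φ.S X)) =
        (H Z).functor.map ((P.mapComp f g).hom.nat.app (Φ.S X)) ≫
          (n g).hom.nat.app ((P.map f).functor.obj (Φ.S X)) ≫
            (Q.map g).functor.map ((n f).hom.nat.app (Φ.S X)) := by
    let i : (Q.map g).functor.obj ((Q.map f).functor.obj ((H X).functor.obj (Φ.S X))) ≅ Ψ.S Z :=
      (Q.map g).functor.mapIso ((Q.map f).functor.mapIso (h X) ≪≫ Ψ.φ f) ≪≫ Ψ.φ g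
    -- After composing with the isomorphism `i` and multiplying by the cocycle value, both sides
    -- become `φ (f ≫ g)` carried by `H Z` to `Ψ.S Z`: one by `φ_comp` for `Ψ`, the other by
    -- `φ_comp` for `Φ`.
    rw [← cancel_mono i.hom]
    apply smul_right_injective _ (α.val g.as f.as).ne_zero
    have hl : (n (f ≫ g)).hom.nat.app (Φ.S X) ≫
        (Q.mapComp f g).hom.nat.app ((H X).functor.obj (Φ.S X)) ≫
          (Q.map g).functor.map ((Q.map f).functor.map (h X).hom) =
        (n (f ≫ g)).hom.nat.app (Φ.S X) ≫ (Q.map (f ≫ g)).functor.map (h X).hom ≫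
          (Q.mapComp f g).hom.nat.app (Ψ.S X) :=
      congrArg _ (twoCell_naturality (Q.mapComp f g).hom (h X).hom).symm
    have hr : (H Z).functor.map ((P.map g).functor.map (Φ.φ f).hom) ≫ (n g).hom.nat.app (Φ.S Y) =
        (n g).hom.nat.app ((P.map f).functor.obj (Φ.S X)) ≫
          (Q.map g).functor.map ((H Y).functor.map (Φ.φ f).hom) :=
      twoCell_naturality (n g).hom (Φ.φ f).hom
    have hf := congrArg (fun a => (Q.map g).functor.map a) (hn f)
    simp only [Functor.map_comp] at hf
    trans (H Z).functor.map (Φ.φ (f ≫ g)).hom ≫ (h Z).hom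
    · rw [← hn, ← Ψ.φ_comp]
      simp only [i, Iso.trans_hom, Functor.mapIso_hom, Functor.map_comp, Category.assoc,
        Linear.comp_smul]
      congr 1
      simpa only [Category.assoc] using
        congrArg (· ≫ (Q.map g).functor.map (Ψ.φ f).hom ≫ (Ψ.φ g).hom) hl
    · rw [← Φ.φ_comp, Functor.map_smul, Linear.smul_comp]
      congr 1
      simp only [i, Iso.trans_hom, Functor.mapIso_hom, Functor.map_comp, Category.assoc]
      rw [← hn g, reassoc_of% hr]
      have := congrArg (fun a => (H Z).functor.map ((P.mapComp f g).hom.nat.app (Φ.S X)) ≫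
          (n g).hom.nat.app ((P.map f).functor.obj (Φ.S X)) ≫ a ≫ (Ψ.φ g).hom) hf.symm
      simpa only [Category.assoc] using this
  let η : P ⟶ Q := Pseudofunctor.StrongTrans.mk
    (app := H) (naturality := n)
    (naturality_naturality := fun {X Y f g} β => by
      obtain rfl := obj_ext_of_isDiscrete β
      obtain rfl : β = 𝟙 f := Subsingleton.elim _ _
      rw [P.map₂_id, Q.map₂_id]
      simp)
    (naturality_id := fun X => (Φ.gen X).twoCell_ext (by
      refine (h_id X).trans ?_
      let x := (H X).functor.map ((P.mapId X).hom.nat.app (Φ.S X))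
      change x = x ≫ 𝟙 _ ≫ 𝟙 _
      simp))
    (naturality_comp := fun {X Y Z} f g => (Φ.gen X).twoCell_ext (by
      refine (h_comp f g).trans ?_
      let x := (H Z).functor.map ((P.mapComp f g).hom.nat.app (Φ.S X))
      let y := (n g).hom.nat.app ((P.map f).functor.obj (Φ.S X))
      let z := (Q.map g).functor.map ((n f).hom.nat.app (Φ.S X))
      change x ≫ y ≫ z = x ≫ 𝟙 _ ≫ y ≫ 𝟙 _ ≫ z ≫ 𝟙 _
      simp only [Category.comp_id, Category.id_comp]))
  exact ⟨η, h, ⟨hn⟩⟩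

/-- Framing-preserving transformations exist in both directions; their composites and the identities
preserve the same framings and are therefore isomorphic. Adjointification corrects these
isomorphisms to an adjoint equivalence. -/
theorem Framing.nonempty_equivalence (Φ : Framing P α) (Ψ : Framing Q α) :
    Nonempty (Bicategory.Equivalence P Q) := by
  obtain ⟨η, h, hη⟩ := Φ.exists_preserves Ψ
  obtain ⟨θ, h', hθ⟩ := Ψ.exists_preserves Φ
  exact ⟨.mkOfAdjointifyCounit ((Framing.Preserves.id Φ).nonempty_iso (hη.comp hθ)).some
    ((hθ.comp hη).nonempty_iso (Framing.Preserves.id Ψ)).some⟩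

end Framing

/-! ### Existence of framings -/

theorem finrank_hom_map {C D : Type*} [Category.{0} C] [Preadditive C] [Linear ℂ C]
    [Category.{0} D] [Preadditive D] [Linear ℂ D] (F : C ⥤ D) [F.Additive] [F.Linear ℂ] [F.Full]
    [F.Faithful] (X Y : C) :
    Module.finrank ℂ (F.obj X ⟶ F.obj Y) = Module.finrank ℂ (X ⟶ Y) :=
  (LinearEquiv.ofBijective (F.mapLinearMap ℂ) ⟨F.map_injective, F.map_surjective⟩ :
    (X ⟶ Y) ≃ₗ[ℂ] (F.obj X ⟶ F.obj Y)).finrank_eq.symm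

theorem IsSimpleGenerator.finrank_end {C : Type*} [Category.{0} C] [Preadditive C] [Linear ℂ C]
    {S : C} (hS : IsSimpleGenerator S) : Module.finrank ℂ (S ⟶ S) = 1 := by
  rw [← hS.scalarEquiv.finrank_eq, Module.finrank_self]

theorem isEquivalence_functor {V W : TwoVect} {F : V ⟶ W} {G : W ⟶ V} (e : 𝟙 V ≅ F ≫ G)
    (e' : G ≫ F ≅ 𝟙 W) : F.functor.IsEquivalence :=
  (CategoryTheory.Equivalence.mk F.functor G.functor
    (NatIso.ofComponents (fun X => appIso e X) fun f => twoCell_naturality e.hom f)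
    (NatIso.ofComponents (fun X => appIso e' X) fun f =>
      twoCell_naturality e'.hom f)).isEquivalence_functor

theorem isEquivalence_app {B : Type u} [Bicategory.{w, v} B] {P Q : B ⥤ᵖ TwoVect}
    (e : Bicategory.Equivalence P Q) (b : B) : (e.hom.app b).functor.IsEquivalence :=
  isEquivalence_functor (G := e.inv.app b)
    ⟨e.unit.hom.as.app b, e.unit.inv.as.app b,
      congrArg (fun m : 𝟙 P ⟶ 𝟙 P => m.as.app b) e.unit.hom_inv_id,
      congrArg (fun m : e.hom ≫ e.inv ⟶ e.hom ≫ e.inv => m.as.app b) e.unit.inv_hom_id⟩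
    ⟨e.counit.hom.as.app b, e.counit.inv.as.app b,
      congrArg (fun m : e.inv ≫ e.hom ⟶ e.inv ≫ e.hom => m.as.app b) e.counit.hom_inv_id,
      congrArg (fun m : 𝟙 Q ⟶ 𝟙 Q => m.as.app b) e.counit.inv_hom_id⟩

theorem isEquivalence_app_inv {B : Type u} [Bicategory.{w, v} B] {P Q : B ⥤ᵖ TwoVect}
    (e : Bicategory.Equivalence P Q) (b : B) : (e.inv.app b).functor.IsEquivalence :=
  isEquivalence_functor (G := e.hom.app b)
    ⟨e.counit.inv.as.app b, e.counit.hom.as.app b,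
      congrArg (fun m : 𝟙 Q ⟶ 𝟙 Q => m.as.app b) e.counit.inv_hom_id,
      congrArg (fun m : e.inv ≫ e.hom ⟶ e.inv ≫ e.hom => m.as.app b) e.counit.hom_inv_id⟩
    ⟨e.unit.inv.as.app b, e.unit.hom.as.app b,
      congrArg (fun m : e.hom ≫ e.inv ⟶ e.hom ≫ e.inv => m.as.app b) e.unit.inv_hom_id,
      congrArg (fun m : 𝟙 P ⟶ 𝟙 P => m.as.app b) e.unit.hom_inv_id⟩

/-- A 2-vector space with one simple object. -/
theorem isSimpleGenerator_of_subsingleton {C : Type 1} [Category.{0} C] [Preadditive C]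
    [Linear ℂ C] [HasFiniteBiproducts C] {n : ℕ} [Subsingleton (Fin n)] {S : Fin n → C}
    (hS : ∀ i j, Module.finrank ℂ (S i ⟶ S j) = if i = j then 1 else 0)
    (hSd : ∀ X : C, ∃ (m : ℕ) (f : Fin m → Fin n), Nonempty (X ≅ ⨁ fun k => S (f k)))
    (i : Fin n) : IsSimpleGenerator (S i) := by
  have h1 : Module.finrank ℂ (S i ⟶ S i) = 1 := by rw [hS, if_pos rfl]
  have hne : 𝟙 (S i) ≠ 0 := fun h => by
    have : Subsingleton (S i ⟶ S i) := ⟨fun f g => by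
      rw [← Category.id_comp f, ← Category.id_comp g, h, zero_comp, zero_comp]⟩
    rw [Module.finrank_zero_of_subsingleton] at h1
    exact zero_ne_one h1
  refine ⟨fun f => ?_, hne, fun X => ?_⟩
  · obtain ⟨c, hc⟩ := (finrank_eq_one_iff_of_nonzero' (𝟙 (S i)) hne).1 h1 f
    exact ⟨c, hc.symm⟩
  · obtain ⟨m, f, ⟨e⟩⟩ := hSd X
    obtain rfl : f = fun _ => i := Subsingleton.elim _ _
    refine ⟨m, fun k => e.hom ≫ biproduct.π (fun _ => S i) k,
      fun k => biproduct.ι (fun _ => S i) k ≫ e.inv, ?_⟩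
    simp only [Category.assoc, ← Preadditive.comp_sum]
    simp only [← Category.assoc, ← Preadditive.sum_comp]
    simp [biproduct.total]

/-- Without simple objects, every object is an empty biproduct, that is, zero. -/
theorem subsingleton_hom_of_isEmpty {C : Type 1} [Category.{0} C] [Preadditive C]
    [HasFiniteBiproducts C] {n : ℕ} [IsEmpty (Fin n)] {S : Fin n → C}
    (hSd : ∀ X : C, ∃ (m : ℕ) (f : Fin m → Fin n), Nonempty (X ≅ ⨁ fun k => S (f k)))
    (X Y : C) : Subsingleton (X ⟶ Y) := by
  obtain ⟨m, f, ⟨e⟩⟩ := hSd X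
  have : IsEmpty (Fin m) := Function.isEmpty f
  refine ⟨fun a b => ?_⟩
  rw [← cancel_epi e.inv]
  ext k
  exact isEmptyElim k

/-- A tensor factor of `vect` has one simple object. -/
theorem exists_isSimpleGenerator {V W : TwoVect} (F : deligne V W ⟶ vect)
    (hF : F.functor.IsEquivalence) : ∃ S : V.carrier, IsSimpleGenerator S := by
  obtain ⟨n, S, -, hS', hSd⟩ := V.isKV
  obtain ⟨m, T, -, hT', hTd⟩ := W.isKV
  let E : Mat_ (Tens V.carrier W.carrier) ⥤ FGModuleCat.{0} ℂ := F.functor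
  have : E.IsEquivalence := hF
  have : E.Additive := F.additive
  have : E.Linear ℂ := F.linear
  -- If all these spaces vanished, every object of the tensor product would be zero, including a
  -- preimage of the nonzero object `ℂ`. Hence both factors have a simple object.
  have hne (h : ∀ X Y : Tens V.carrier W.carrier, Subsingleton (X ⟶ Y)) : False := by
    let M := E.objPreimage (FGModuleCat.of ℂ ℂ)
    have hM : 𝟙 M = 0 := funext fun i => funext fun j => (h _ _).elim _ _
    refine isSimpleGenerator_complex.id_ne_zero ?_
    let e := E.objObjPreimageIso (FGModuleCat.of ℂ ℂ)
    rw [← e.inv_hom_id, ← Category.id_comp e.hom, ← E.map_id]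
    change e.inv ≫ E.map (𝟙 M) ≫ e.hom = 0
    rw [hM, E.map_zero, zero_comp, comp_zero]
  obtain ⟨i⟩ : Nonempty (Fin n) := by
    by_contra h
    have : IsEmpty (Fin n) := not_nonempty_iff.1 h
    refine hne fun X Y => ?_
    have := subsingleton_hom_of_isEmpty hSd X.left Y.left
    exact inferInstanceAs (Subsingleton ((X.left ⟶ Y.left) ⊗[ℂ] (X.right ⟶ Y.right)))
  obtain ⟨j⟩ : Nonempty (Fin m) := by
    by_contra h
    have : IsEmpty (Fin m) := not_nonempty_iff.1 h
    refine hne fun X Y => ?_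
    have := subsingleton_hom_of_isEmpty hTd X.right Y.right
    exact inferInstanceAs (Subsingleton ((X.left ⟶ Y.left) ⊗[ℂ] (X.right ⟶ Y.right)))
  -- Tensoring with one fixed simple object of `W` keeps the morphism dimensions between the simples
  -- of `V`.
  let R (i : Fin n) : Mat_ (Tens V.carrier W.carrier) := (Mat_.embedding _).obj ⟨S i, T j⟩
  have hR (i i' : Fin n) : Module.finrank ℂ (R i ⟶ R i') = if i = i' then 1 else 0 := by
    let e : (R i ⟶ R i') ≃ₗ[ℂ] (S i ⟶ S i') ⊗[ℂ] (T j ⟶ T j) :=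
      (LinearEquiv.funUnique PUnit ℂ (PUnit → (S i ⟶ S i') ⊗[ℂ] (T j ⟶ T j))) ≪≫ₗ
        LinearEquiv.funUnique PUnit ℂ _
    rw [e.finrank_eq, Module.finrank_tensorProduct, hS', hT', if_pos rfl, mul_one]
  have hE (i : Fin n) : Module.finrank ℂ (E.obj (R i)) = 1 := by
    have h := finrank_hom_map E (R i) (R i)
    rw [hR, if_pos rfl, finrank_fgModuleCat_hom] at h
    exact Nat.eq_one_of_mul_eq_one_right h
  -- `E` sends each `R i` to a line, and the space of maps between two lines has dimension one,
  -- whereas distinct indices would give dimension zero.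
  have : Subsingleton (Fin n) := ⟨fun i i' => by
    have h := finrank_hom_map E (R i) (R i')
    rw [hR, finrank_fgModuleCat_hom, hE, hE] at h
    by_contra hi
    rw [if_neg hi] at h
    exact one_ne_zero h⟩
  exact ⟨S i, isSimpleGenerator_of_subsingleton hS' hSd i⟩

section
variable {G : Type u} [Groupoid.{v} G]

theorem isEquivalence_map (P : LocallyDiscrete G ⥤ᵖ TwoVect) {X Y : LocallyDiscrete G}
    (f : X ⟶ Y) : (P.map f).functor.IsEquivalence := by
  let f' : Y ⟶ X := ⟨Groupoid.inv f.as⟩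
  have h : f ≫ f' = 𝟙 X := congrArg Discrete.mk (Groupoid.comp_inv f.as)
  have h' : f' ≫ f = 𝟙 Y := congrArg Discrete.mk (Groupoid.inv_comp f.as)
  exact isEquivalence_functor (G := P.map f')
    ((P.mapId X).symm ≪≫ eqToIso (congrArg P.map h.symm) ≪≫ P.mapComp f f')
    ((P.mapComp f' f).symm ≪≫ eqToIso (congrArg P.map h') ≪≫ P.mapId Y)

/-- `P(f)` is an equivalence, so it sends a simple generator to an object with one-dimensional
endomorphisms, which must be isomorphic to the generator of the target. The failure of the chosen
isomorphisms to be multiplicative is the cocycle. -/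
theorem exists_framing (P : LocallyDiscrete G ⥤ᵖ TwoVect)
    (h : ∀ X, ∃ S : (P.obj X).carrier, IsSimpleGenerator S) :
    ∃ α : TwoCocycle G, Nonempty (Framing P α) := by
  choose S gen using h
  have hφ {X Y : LocallyDiscrete G} (f : X ⟶ Y) :
      Nonempty ((P.map f).functor.obj (S X) ≅ S Y) := by
    have := isEquivalence_map P f
    refine (gen Y).nonempty_iso ?_
    rw [finrank_hom_map, (gen X).finrank_end]
  let φ {X Y : LocallyDiscrete G} (f : X ⟶ Y) := (hφ f).some
  have hc {X Y Z : LocallyDiscrete G} (f : X ⟶ Y) (g : Y ⟶ Z) :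
      ∃ c : ℂˣ, (φ (f ≫ g)).hom = (c : ℂ) • ((P.mapComp f g).hom.nat.app (S X) ≫
        (P.map g).functor.map (φ f).hom ≫ (φ g).hom) :=
    (gen Z).exists_units_smul (φ (f ≫ g))
      (appIso (P.mapComp f g) (S X) ≪≫ (P.map g).functor.mapIso (φ f) ≪≫ φ g)
  choose c hc using @hc
  refine ⟨⟨fun {X Y Z} g f => c (X := ⟨X⟩) (Y := ⟨Y⟩) (Z := ⟨Z⟩) ⟨f⟩ ⟨g⟩, ?_⟩,
    ⟨⟨S, gen, φ, fun f g => (hc f g).symm⟩⟩⟩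
  intro W' X' Y' Z' f₁ f₂ f₃
  let W : LocallyDiscrete G := ⟨W'⟩
  let X : LocallyDiscrete G := ⟨X'⟩
  let Y : LocallyDiscrete G := ⟨Y'⟩
  let Z : LocallyDiscrete G := ⟨Z'⟩
  let f : W ⟶ X := ⟨f₁⟩
  let g : X ⟶ Y := ⟨f₂⟩
  let k : Y ⟶ Z := ⟨f₃⟩
  change c f (g ≫ k) * c g k = c (f ≫ g) k * c f g
  -- The unscaled composite through all three morphisms. The isomorphism chosen for the triple
  -- composite is a multiple of it in two ways, one for each bracketing; comparing the coefficients
  -- gives the cocycle identity.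
  let i : (P.map ((f ≫ g) ≫ k)).functor.obj (S W) ≅ S Z :=
    appIso (P.mapComp (f ≫ g) k) (S W) ≪≫
      (P.map k).functor.mapIso (appIso (P.mapComp f g) (S W)) ≪≫
        (P.map k).functor.mapIso ((P.map g).functor.mapIso (φ f)) ≪≫
          (P.map k).functor.mapIso (φ g) ≪≫ φ k
  have hl : ((c (f ≫ g) k * c f g : ℂˣ) : ℂ) • i.hom = (φ ((f ≫ g) ≫ k)).hom := by
    rw [hc (f ≫ g) k, hc f g, Units.val_mul, mul_smul]
    simp [i, Functor.map_smul]
  have hr : ((c f (g ≫ k) * c g k : ℂˣ) : ℂ) • i.hom = (φ ((f ≫ g) ≫ k)).hom := by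
    have hα := map₂_app_comp (P := P) (α_ f g k).hom fun f => (φ f).hom
    rw [← hα, hc f (g ≫ k), hc g k, Units.val_mul, mul_smul]
    have e := mapComp_assoc_app (P := P) f g k (S W)
    have e' : (P.map (g ≫ k)).functor.map (φ f).hom ≫ (P.mapComp g k).hom.nat.app (S X) =
        (P.mapComp g k).hom.nat.app ((P.map f).functor.obj (S W)) ≫
          (P.map k).functor.map ((P.map g).functor.map (φ f).hom) :=
      twoCell_naturality (P.mapComp g k).hom (φ f).hom
    simp only [i, Iso.trans_hom, Functor.mapIso_hom, appIso_hom, Linear.comp_smul]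
    congr 2
    have e₁ := congrArg (· ≫ (P.map k).functor.map ((P.map g).functor.map (φ f).hom) ≫
      (P.map k).functor.map (φ g).hom ≫ (φ k).hom) e
    simp only [Category.assoc] at e₁
    refine e₁.trans ?_
    rw [reassoc_of% e']
  exact Units.ext ((gen Z).smul_hom_injective i (hr.trans hl.symm))

/-- The tautological framing of a 2-cocycle. -/
def TwoCocycle.framing (α : TwoCocycle G) : Framing α.toTwoVect α where
  S _ := FGModuleCat.of ℂ ℂ
  gen _ := isSimpleGenerator_complex
  φ _ := Iso.refl (FGModuleCat.of ℂ ℂ)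
  φ_comp f g := by
    let c := α.val g.as f.as
    -- The compositor `mapComp` of `α.toTwoVect` is multiplication by the inverse of the cocycle
    -- value, which the factor in `φ_comp` cancels.
    change (c : ℂ) • (((((c⁻¹ : ℂˣ) : ℂ) • 𝟙 (FGModuleCat.of ℂ ℂ)) ≫ 𝟙 (FGModuleCat.of ℂ ℂ)) ≫
      𝟙 (FGModuleCat.of ℂ ℂ) ≫ 𝟙 (FGModuleCat.of ℂ ℂ)) = 𝟙 (FGModuleCat.of ℂ ℂ)
    rw [Category.comp_id, Category.comp_id, Category.comp_id, smul_smul, Units.mul_inv, one_smul]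

/-- The framing of `L.comp P` and the tautological one of `α` belong to the same cocycle by
construction. -/
theorem exists_twoCocycle {B : Type u'} [Bicategory.{w', v'} B] (L : LocallyDiscrete G ⥤ᵖ B)
    (P : B ⥤ᵖ TwoVect) (hP : IsInvertible P) :
    ∃ α : TwoCocycle G, Nonempty (Bicategory.Equivalence α.toTwoVect (L.comp P)) := by
  obtain ⟨Q, ⟨e⟩⟩ := hP
  obtain ⟨α, ⟨Φ⟩⟩ := exists_framing (L.comp P) fun X =>
    exists_isSimpleGenerator (V := P.obj (L.obj X)) (W := Q.obj (L.obj X))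
      (e.hom.app (L.obj X)) (isEquivalence_app e (L.obj X))
  exact ⟨α, α.framing.nonempty_equivalence Φ⟩

end

/-! ### Uniqueness of the 2-cocycle -/

section
variable {G : Type u} [Groupoid.{v} G]

theorem smul_eq_smul_of_comp {C D : Type*} [Category.{0} C] [Preadditive C] [Linear ℂ C]
    [Category.{0} D] [Preadditive D] [Linear ℂ D] (F : C ⥤ D) [F.Additive] [F.Linear ℂ] {X : C}
    {Y : D} {f g : F.obj X ⟶ Y} {a b : ℂ}
    (h : f ≫ (a • 𝟙 Y) ≫ 𝟙 Y = F.map ((b • 𝟙 X) ≫ 𝟙 X) ≫ g) : a • f = b • g := by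
  simpa [Functor.map_smul] using h

/-- Each component of the composite equivalence from `α'` to `α` sends `ℂ` to a line. Once these
lines are identified with `ℂ`, the naturality 2-cells are the scalars of a coboundary. -/
theorem cohomologous_of_equivalence {P : LocallyDiscrete G ⥤ᵖ TwoVect} {α α' : TwoCocycle G}
    (e : Bicategory.Equivalence α.toTwoVect P) (e' : Bicategory.Equivalence α'.toTwoVect P) :
    α.Cohomologous α' := by
  let η : α'.toTwoVect ⟶ α.toTwoVect := e'.hom ≫ e.inv
  let F (X : LocallyDiscrete G) : FGModuleCat.{0} ℂ ⥤ FGModuleCat.{0} ℂ := (η.app X).functor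
  have hF (X) : (F X).Additive := (η.app X).additive
  have hF' (X) : (F X).Linear ℂ := (η.app X).linear
  have hι (X : LocallyDiscrete G) :
      Nonempty ((F X).obj (FGModuleCat.of ℂ ℂ) ≅ FGModuleCat.of ℂ ℂ) := by
    have h₁ := isEquivalence_app e' X
    have h₂ := isEquivalence_app_inv e X
    have : (F X).IsEquivalence :=
      inferInstanceAs ((e'.hom.app X).functor ⋙ (e.inv.app X).functor).IsEquivalence
    refine isSimpleGenerator_complex.nonempty_iso ?_
    rw [finrank_hom_map, isSimpleGenerator_complex.finrank_end]
  let ι (X : LocallyDiscrete G) := (hι X).some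
  let n {X Y : LocallyDiscrete G} (f : X ⟶ Y) :
      (F Y).obj (FGModuleCat.of ℂ ℂ) ≅ (F X).obj (FGModuleCat.of ℂ ℂ) :=
    appIso (η.naturality f) (FGModuleCat.of ℂ ℂ)
  have hσ {X Y : LocallyDiscrete G} (f : X ⟶ Y) :
      ∃ c : ℂˣ, (n f ≪≫ ι X).hom = (c : ℂ) • (ι Y).hom :=
    isSimpleGenerator_complex.exists_units_smul (n f ≪≫ ι X) (ι Y)
  choose σ hσ using @hσ
  -- This is the composition axiom of `η` at `ℂ`. The inverses appear because the compositors of the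
  -- two cocycle theories are multiplication by inverse cocycle values.
  have key {X Y Z : LocallyDiscrete G} (f : X ⟶ Y) (g : Y ⟶ Z) :
      ((α.val g.as f.as)⁻¹ : ℂˣ) * (σ (f ≫ g)) = ((α'.val g.as f.as)⁻¹ : ℂˣ) * (σ f * σ g) := by
    have e := naturality_comp_app η f g (FGModuleCat.of ℂ ℂ)
    let c := α.val g.as f.as
    let c' := α'.val g.as f.as
    let I : FGModuleCat.{0} ℂ := FGModuleCat.of ℂ ℂ
    change (n (f ≫ g)).hom ≫ (((c⁻¹ : ℂˣ) : ℂ) • 𝟙 ((F X).obj I)) ≫ 𝟙 ((F X).obj I) =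
      (F Z).map ((((c'⁻¹ : ℂˣ) : ℂ) • 𝟙 I) ≫ 𝟙 I) ≫ (n g).hom ≫ (n f).hom at e
    have e' := congrArg (· ≫ (ι X).hom) (smul_eq_smul_of_comp (F Z) e)
    simp only [Linear.smul_comp, Category.assoc] at e'
    have h₁ := hσ (f ≫ g)
    have h₂ := hσ f
    have h₃ := hσ g
    simp only [Iso.trans_hom] at h₁ h₂ h₃
    rw [h₁, h₂, Linear.comp_smul, h₃, smul_smul, smul_smul, smul_smul] at e'
    refine Units.ext (isSimpleGenerator_complex.smul_hom_injective (ι Z) ?_)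
    simpa only [Units.val_mul, mul_assoc] using e'
  refine ⟨fun {X Y} g => σ (X := ⟨X⟩) (Y := ⟨Y⟩) ⟨g⟩, fun {X Y Z} f g => ?_⟩
  have h := key (X := ⟨X⟩) (Y := ⟨Y⟩) (Z := ⟨Z⟩) ⟨f⟩ ⟨g⟩
  change (α.val g f)⁻¹ * σ (X := ⟨X⟩) (Y := ⟨Z⟩) ⟨f ≫ g⟩ = (α'.val g f)⁻¹ * _ at h
  rw [inv_mul_eq_iff_eq_mul, mul_left_comm, eq_inv_mul_iff_mul_eq] at h
  rw [mul_comm, h, mul_assoc]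

end

/-! ### Projective representations from anomalous theories -/

section
variable {B : Type u} [Bicategory.{w, v} B] {C : Type u'} [Bicategory.{w', v'} C]
  {P Q R : B ⥤ᵖ C}

/-- `laxOfStrong` uses the inverses of the naturality 2-cells, so the modification axiom is needed
for these inverses. -/
theorem modification_naturality_inv {η θ : P ⟶ Q} (m : η ⟶ θ) {a b : B} (f : a ⟶ b) :
    m.as.app a ▷ Q.map f ≫ (θ.naturality f).inv = (η.naturality f).inv ≫ P.map f ◁ m.as.app b := by
  rw [Iso.comp_inv_eq, Category.assoc, Iso.eq_inv_comp]
  exact (m.as.naturality f).symm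

/-- Isomorphic strong transformations are isomorphic as lax transformations. -/
def laxOfStrongIso {η θ : P ⟶ Q} (e : η ≅ θ) : laxOfStrong η ≅ laxOfStrong θ :=
  Lax.LaxTrans.isoMk
    (fun a => ⟨e.hom.as.app a, e.inv.as.app a,
      congrArg (fun m : η ⟶ η => m.as.app a) e.hom_inv_id,
      congrArg (fun m : θ ⟶ θ => m.as.app a) e.inv_hom_id⟩)
    (fun f => modification_naturality_inv e.hom f)

/-- `laxOfStrong` preserves identities. -/
def laxOfStrongId : laxOfStrong (𝟙 P) ≅ 𝟙 P.toLax :=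
  Lax.LaxTrans.isoMk (fun a => Iso.refl (𝟙 (P.obj a))) (fun {a b} f => by
    change 𝟙 (𝟙 (P.obj a)) ▷ P.map f ≫ (λ_ (P.map f)).hom ≫ (ρ_ (P.map f)).inv =
      ((λ_ (P.map f)).hom ≫ (ρ_ (P.map f)).inv) ≫ P.map f ◁ 𝟙 (𝟙 (P.obj b))
    simp)

/-- `laxOfStrong` preserves composition. -/
def laxOfStrongComp (η : P ⟶ Q) (θ : Q ⟶ R) :
    laxOfStrong (η ≫ θ) ≅ laxOfStrong η ≫ laxOfStrong θ :=
  Lax.LaxTrans.isoMk (fun a => Iso.refl (η.app a ≫ θ.app a)) (fun {a b} f => by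
    have h : ((η ≫ θ).naturality f).inv = (α_ _ _ _).hom ≫ η.app a ◁ (θ.naturality f).inv ≫
        (α_ _ _ _).inv ≫ (η.naturality f).inv ▷ θ.app b ≫ (α_ _ _ _).hom := by
      refine Eq.trans (b := ((((α_ _ _ _).hom ≫ η.app a ◁ (θ.naturality f).inv) ≫
        (α_ _ _ _).inv) ≫ (η.naturality f).inv ▷ θ.app b) ≫ (α_ _ _ _).hom) ?_ (by simp)
      rfl
    change 𝟙 (η.app a ≫ θ.app a) ▷ R.map f ≫ (α_ _ _ _).hom ≫ η.app a ◁ (θ.naturality f).inv ≫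
        (α_ _ _ _).inv ≫ (η.naturality f).inv ▷ θ.app b ≫ (α_ _ _ _).hom =
      ((η ≫ θ).naturality f).inv ≫ P.map f ◁ 𝟙 (η.app b ≫ θ.app b)
    rw [h]
    simp)

end

section
variable {G : Type u} [Groupoid.{v} G]

/-- The projective representation obtained by evaluating a natural 2-transformation `1 ⇒ α` at
the simple generator. -/
def ProjRep.ofTrans {α : TwoCocycle G}
    (A : (trivialTheory (LocallyDiscrete G)).toLax ⟶ α.toTwoVect.toLax) : ProjRep α where
  V X := (A.app ⟨X⟩).functor.obj (FGModuleCat.of ℂ ℂ)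
  ρ {X Y} g := (A.naturality (⟨g⟩ : (⟨X⟩ : LocallyDiscrete G) ⟶ ⟨Y⟩)).nat.app (FGModuleCat.of ℂ ℂ)
  ρ_id X := by
    have h := congrArg (fun a => LinFun.Hom.nat a) (A.naturality_id ⟨X⟩)
    have h' := congrArg (fun a => NatTrans.app a (FGModuleCat.of ℂ ℂ)) h
    let V : FGModuleCat.{0} ℂ := (A.app ⟨X⟩).functor.obj (FGModuleCat.of ℂ ℂ)
    let c := α.val (𝟙 X) (𝟙 X)
    let r : V ⟶ V := (A.naturality (𝟙 (⟨X⟩ : LocallyDiscrete G))).nat.app (FGModuleCat.of ℂ ℂ)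
    -- The unit axiom at `ℂ`: the inverse unit constraint of `α.toTwoVect` contributes the inverse
    -- scalar.
    have e : (((c⁻¹ : ℂˣ) : ℂ) • 𝟙 V) ≫ r = 𝟙 V ≫ 𝟙 V ≫ 𝟙 V :=
      h'.trans (congrArg (fun a => 𝟙 V ≫ 𝟙 V ≫ a)
        ((A.app ⟨X⟩).functor.map_id (FGModuleCat.of ℂ ℂ)))
    change r = (c : ℂ) • 𝟙 V
    rw [Linear.smul_comp, Category.id_comp, Category.id_comp, Category.id_comp] at e
    rw [← e, smul_smul, Units.mul_inv, one_smul]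
  ρ_comp {X Y Z} g₁ g₂ := by
    let f : (⟨X⟩ : LocallyDiscrete G) ⟶ ⟨Y⟩ := ⟨g₁⟩
    let g : (⟨Y⟩ : LocallyDiscrete G) ⟶ ⟨Z⟩ := ⟨g₂⟩
    have h := congrArg (fun a => LinFun.Hom.nat a) (A.naturality_comp f g)
    have h' := congrArg (fun a => NatTrans.app a (FGModuleCat.of ℂ ℂ)) h
    let V (X : G) : FGModuleCat.{0} ℂ := (A.app ⟨X⟩).functor.obj (FGModuleCat.of ℂ ℂ)
    let c := α.val g₂ g₁
    let r₁ : V X ⟶ V Y := (A.naturality f).nat.app (FGModuleCat.of ℂ ℂ)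
    let r₂ : V Y ⟶ V Z := (A.naturality g).nat.app (FGModuleCat.of ℂ ℂ)
    let r : V X ⟶ V Z := (A.naturality (f ≫ g)).nat.app (FGModuleCat.of ℂ ℂ)
    -- The composition axiom at `ℂ`: a lax transformation meets the inverse compositor, so the
    -- cocycle value enters uninverted.
    have e : (𝟙 (V X) ≫ ((c : ℂ) • 𝟙 (V X))) ≫ r = 𝟙 (V X) ≫ r₁ ≫ 𝟙 (V Y) ≫ r₂ ≫ 𝟙 (V Z) ≫ 𝟙 (V Z) :=
      h'.trans (congrArg (fun a => 𝟙 (V X) ≫ r₁ ≫ 𝟙 (V Y) ≫ r₂ ≫ 𝟙 (V Z) ≫ a)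
        ((A.app ⟨Z⟩).functor.map_id (FGModuleCat.of ℂ ℂ)))
    change r₁ ≫ r₂ = (c : ℂ) • r
    simpa using e.symm

open MonoidalCategory in
/-- A natural 2-transformation `1 ⇒ α` is given by a projective representation. -/
theorem ProjRep.nonempty_iso_ofTrans {α : TwoCocycle G}
    (A : (trivialTheory (LocallyDiscrete G)).toLax ⟶ α.toTwoVect.toLax) :
    Nonempty (A ≅ (ProjRep.ofTrans A).toTrans) := by
  let I : FGModuleCat.{0} ℂ := FGModuleCat.of ℂ ℂ
  let V (X : LocallyDiscrete G) : FGModuleCat.{0} ℂ := (A.app X).functor.obj I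
  -- Linear functors out of `vect` are determined up to isomorphism by their value at `ℂ`, and the
  -- left unitor identifies the value of `– ⊗ V X` with `V X`.
  let i (X : LocallyDiscrete G) : A.app X ≅ tensorWith (V X) :=
    isSimpleGenerator_complex.twoCellIso (V := vect) (W := vect) (F := A.app X)
      (G := tensorWith (V X)) (λ_ (V X)).symm
  have hi (X : LocallyDiscrete G) : (i X).hom.nat.app I = (λ_ (V X)).inv :=
    isSimpleGenerator_complex.twoCellIso_app (V := vect) (W := vect) (F := A.app X)
      (G := tensorWith (V X)) (λ_ (V X)).symm
  refine ⟨Lax.LaxTrans.isoMk i fun {X Y} f => ?_⟩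
  refine IsSimpleGenerator.twoCell_ext (V := vect) isSimpleGenerator_complex ?_
  let r : V X ⟶ V Y := (A.naturality f).nat.app I
  -- At `ℂ` the modification axiom is naturality of the inverse left unitor.
  change (i X).hom.nat.app I ≫ 𝟙 (I ⊗ V X) ≫ (I ◁ r) ≫ 𝟙 (I ⊗ V Y) = r ≫ (i Y).hom.nat.app I
  rw [hi, hi]
  have cancel {D : Type 1} [Category.{0} D] {K L M N : D} {a : K ⟶ L} {b : L ⟶ M} {c : K ⟶ N}
      {d : N ⟶ M} (h : c ≫ d = a ≫ b) : a ≫ 𝟙 L ≫ b ≫ 𝟙 M = c ≫ d := by simp [h]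
  exact cancel (MonoidalCategory.leftUnitor_inv_naturality r)

-- The composite of `A` with the inverse of `e` is a transformation `1 ⇒ α`, hence comes from some
-- `ρ`; composing back with `e.hom` and using the counit recovers `A`. All this takes place among
-- lax transformations, since the 2-cells of `A` need not be invertible.
open scoped Lax.LaxTrans.LaxFunctor in
theorem exists_projRep {P : LocallyDiscrete G ⥤ᵖ TwoVect} {α : TwoCocycle G}
    (e : Bicategory.Equivalence α.toTwoVect P)
    (A : (trivialTheory (LocallyDiscrete G)).toLax ⟶ P.toLax) :
    ∃ ρ : ProjRep α, Nonempty (A ≅ ρ.toTrans ≫ laxOfStrong e.hom) := by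
  obtain ⟨i⟩ := ProjRep.nonempty_iso_ofTrans (A ≫ laxOfStrong e.inv)
  exact ⟨_, ⟨(ρ_ A).symm ≪≫ whiskerLeftIso A (laxOfStrongId.symm ≪≫
    laxOfStrongIso e.counit.symm ≪≫ laxOfStrongComp e.inv e.hom) ≪≫
      (α_ A (laxOfStrong e.inv) (laxOfStrong e.hom)).symm ≪≫
        whiskerRightIso i (laxOfStrong e.hom)⟩⟩

end

end AnomalousQFT

end

theorem mainTheorem9 {n : ℕ} (F : BackgroundFields.{v', u'} n)
    {Cob : Type u} [Bicategory.{w, v} Cob] (lim : LocallyDiscrete (SymCob F) ⥤ᵖ Cob)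
    (𝒜 : Cob ⥤ᵖ TwoVect) (h𝒜 : IsInvertible 𝒜) (A : AnomalousTheory 𝒜) :
    (∃ α : TwoCocycle (SymCob F),
      Nonempty (Bicategory.Equivalence α.toTwoVect (lim.comp 𝒜))) ∧
    (∀ (α : TwoCocycle (SymCob F)) (e : Bicategory.Equivalence α.toTwoVect (lim.comp 𝒜)),
      ∃ ρ : ProjRep α, Nonempty (A.restrict lim ≅ ρ.toTrans ≫ laxOfStrong e.hom)) ∧
    (∀ α α' : TwoCocycle (SymCob F),
      Nonempty (Bicategory.Equivalence α.toTwoVect (lim.comp 𝒜)) →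
      Nonempty (Bicategory.Equivalence α'.toTwoVect (lim.comp 𝒜)) → α.Cohomologous α') :=
  ⟨exists_twoCocycle lim 𝒜 h𝒜, fun _ e => exists_projRep e (A.restrict lim),
    fun _ _ ⟨e⟩ ⟨e'⟩ => cohomologous_of_equivalence e e'⟩
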